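/- Let $d\ge 1$ be an integer. For $f:\mathbb{R}^d\to\mathbb{R}$ locally integrable and $V\subset\mathbb{R}^d$ open put $$\int_V|Df|:=\sup\Big\{\int_V f\,\mathrm{div}\,g\,dx \;:\; g\in C^1_c(V;\mathbb{R}^d),\ \sup|g|\le 1\Big\}.$$ Write $f\in BV(\mathbb{R}^d)$ if $f\in L^1(\mathbb{R}^d)$ and $\int_{\mathbb{R}^d}|Df|<\infty$, and $f\in BV_{\mathrm{loc}}(\mathbb{R}^d)$ if $f\in L^1_{\mathrm{loc}}(\mathbb{R}^d)$ and $\int_V|Df|<\infty$ for every open $V$ with compact closure. In the latter case $|Df|$ also denotes the variation measure, $|Df|(B)=\inf\{\int_V|Df| : V\supset B \text{ open}\}$. For a (vector valued) measure $\nu$ with total variation $|\nu|$, and $B(x;s)$ the closed ball, let $$M\nu(x):=\sup_{s>0}\frac{|\nu|(B(x;s))}{\mathrm{Leb}(B(x;s))},\qquad M_R\nu(x):=\sup_{0<s\le R}\frac{|\nu|(B(x;s))}{\mathrm{Leb}(B(x;s))},$$ with the same notation $M_R(Df)$ for $|\nu|=|Df|$. Let $\|\cdot\|_\infty$ be the essential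 supremum norm with respect to Lebesgue measure. For a measurable $g\ge 0$ let $\|f\|_{L^r(\mathbb{R}^d,g)}:=(\int|f|^r g\,dx)^{1/r}$ if $r<\infty$ and $\|f\|_{L^\infty(\mathbb{R}^d,g)}:=\|f\|_\infty$; $L^r(\mathbb{R}^d,g)$ is the class of measurable $f$ for which this is finite. **Theorem.** (a) There is a constant $K_0>0$, depending only on $d$, such that for every $f\in BV_{\mathrm{loc}}(\mathbb{R}^d)$ there is a Lebesgue null set $N$ with $$|f(x)-f(y)|\le K_0|x-y|\{M_{2|x-y|}(Df)(x)+M_{2|x-y|}(Df)(y)\}\quad\text{for all } x,y\notin N,$$ and there is a constant $A_1>0$, depending only on $d$, such that $\mathrm{Leb}(\{M\nu>\lambda\})\le A_1|\nu|(\mathbb{R}^d)\lambda^{-1}$ for every finite vector valued measure $\nu$ on $\mathbb{R}^d$ and every $\lambda>0$. (b) Let $K_0$, $A_1$ be any constants as in (a). Let $X,\widehat X$ be $\mathbb{R}^d$-valued random variables on a common probability space with densities $p_X,p_{\widehat X}\in L^\infty(\mathbb{R}^d)$ with respect to Lebesgue measure, and let $r\in(1,\infty]$. Then for all $f\in BV(\mathbb{R}^d)\cap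 L^r(\mathbb{R}^d,p_X)\cap L^r(\mathbb{R}^d,p_{\widehat X})$, $p\in(0,\infty)$ and $q\in[1,r)$, $$\mathbb{E}\big[|f(X)-f(\widehat X)|^q\big]\le C_{BV}(p,q,r)\,\mathbb{E}\big[|X-\widehat X|^p\big]^{\frac{1-q/r}{p+1}},\qquad 1/\infty:=0,$$ where (in $[0,\infty]$, with $0\cdot\infty=0$ and $0^0=1$) the finite constant $C_{BV}(p,q,r)$ is $$C_{BV}(p,q,\infty)=(2\|f\|_\infty)^{q-1}\Big(2^{p+1}K_0^p\|f\|_\infty+A_1\{\|p_X\|_\infty+\|p_{\widehat X}\|_\infty\}\int_{\mathbb{R}^d}|Df|\Big)$$ if $r=\infty$; $$C_{BV}(p,q,r)=2^{q-1}\Big(2^{p+1}K_0^p+A_1\{\|p_X\|_\infty+\|p_{\widehat X}\|_\infty\}\int_{\mathbb{R}^d}|Df|\Big)+\big(\|f\|_{L^r(\mathbb{R}^d,p_X)}+\|f\|_{L^r(\mathbb{R}^d,p_{\widehat X})}\big)^r$$ if $r<\infty$ and $\mathbb{E}[|X-\widehat X|^p]<1$; and $$C_{BV}(p,q,r)=\big(\|f\|_{L^r(\mathbb{R}^d,p_X)}+\|f\|_{L^r(\mathbb{R}^d,p_{\widehat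 X})}\big)^q$$ if $r<\infty$ and $\mathbb{E}[|X-\widehat X|^p]\ge 1$. -/

import Mathlib

open MeasureTheory Set
open scoped ENNReal NNReal

noncomputable section

namespace Avikainen

/-- The Euclidean space of dimension `d`, with its Euclidean norm and Lebesgue measure `volume`. -/
abbrev Eucl (d : ℕ) : Type := EuclideanSpace ℝ (Fin d)

/-- The divergence `∑ i, ∂ g_i / ∂ x_i` of a vector field. -/
def divergence {d : ℕ} (g : Eucl d → Eucl d) (x : Eucl d) : ℝ :=
  ∑ i : Fin d, fderiv ℝ g x (EuclideanSpace.single i 1) i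

/-- The admissible test fields on the open set `U`: vector fields of class `C^1` with compact
support contained in `U` (extended by zero outside `U`), of Euclidean norm at most one. -/
def testFields {d : ℕ} (U : Set (Eucl d)) : Set (Eucl d → Eucl d) :=
  {g | ContDiff ℝ 1 g ∧ HasCompactSupport g ∧ tsupport g ⊆ U ∧ ∀ x, ‖g x‖ ≤ 1}

/-- The total variation `∫_U |Df|` of `f` in the open set `U`. The supremum is nonnegative since
the zero field is admissible, so that `ENNReal.ofReal` does not change it. -/
def totalVariation {d : ℕ} (f : Eucl d → ℝ) (U : Set (Eucl d)) : ℝ≥0∞ :=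
  ⨆ g ∈ testFields U, ENNReal.ofReal (∫ x in U, f x * divergence g x)

/-- Functions of bounded variation in the whole space. -/
structure IsBV {d : ℕ} (f : Eucl d → ℝ) : Prop where
  integrable : Integrable f volume
  totalVariation_lt_top : totalVariation f univ < ∞

/-- Functions of locally bounded variation in the whole space. -/
structure IsLocBV {d : ℕ} (f : Eucl d → ℝ) : Prop where
  locallyIntegrable : LocallyIntegrable f volume
  totalVariation_lt_top : ∀ V : Set (Eucl d), IsOpen V → IsCompact (closure V) →
    totalVariation f V < ∞

/-- The value `|Df|(B)` of the variation measure of `f` on an arbitrary set `B`: on open sets it is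
the total variation of `f`, on the other sets it is obtained by outer regularity. -/
def variationMeasure {d : ℕ} (f : Eucl d → ℝ) (B : Set (Eucl d)) : ℝ≥0∞ :=
  ⨅ (V : Set (Eucl d)) (_ : IsOpen V) (_ : B ⊆ V), totalVariation f V

/-- The Hardy-Littlewood maximal function of a nonnegative set function
(the total variation `|ν|` of a measure `ν`), over all closed balls centred at `x`. -/
def maximal {d : ℕ} (ν : Set (Eucl d) → ℝ≥0∞) (x : Eucl d) : ℝ≥0∞ :=
  ⨆ (s : ℝ) (_ : 0 < s), ν (Metric.closedBall x s) / volume (Metric.closedBall x s)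

/-- The restricted Hardy-Littlewood maximal function: only radii `0 < s ≤ R` are used. -/
def restrictedMaximal {d : ℕ} (R : ℝ) (ν : Set (Eucl d) → ℝ≥0∞) (x : Eucl d) : ℝ≥0∞ :=
  ⨆ (s : ℝ) (_ : 0 < s) (_ : s ≤ R), ν (Metric.closedBall x s) / volume (Metric.closedBall x s)

/-- The admissible constants `K₀ > 0` in the pointwise estimate
`|f x - f y| ≤ K₀ |x - y| (M_{2|x-y|}(Df)(x) + M_{2|x-y|}(Df)(y))`, valid off a Lebesgue null set
for every function of locally bounded variation in dimension `d`. -/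
def pointwiseConstants (d : ℕ) : Set ℝ≥0 :=
  {K₀ | 0 < K₀ ∧ ∀ f : Eucl d → ℝ, IsLocBV f →
    ∃ N : Set (Eucl d), MeasurableSet N ∧ volume N = 0 ∧ ∀ x ∉ N, ∀ y ∉ N,
      ENNReal.ofReal |f x - f y| ≤ K₀ * ENNReal.ofReal ‖x - y‖ *
        (restrictedMaximal (2 * ‖x - y‖) (variationMeasure f) x +
          restrictedMaximal (2 * ‖x - y‖) (variationMeasure f) y)}

/-- The admissible constants `A₁ > 0` in the Hardy-Littlewood weak type estimate
`Leb {M ν > t} ≤ A₁ |ν|(ℝ^d) / t` in dimension `d`. The estimate involves a finite vector valued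
measure only through its total variation, which is an arbitrary finite nonnegative measure. -/
def weakTypeConstants (d : ℕ) : Set ℝ≥0 :=
  {A₁ | 0 < A₁ ∧ ∀ ν : Measure (Eucl d), IsFiniteMeasure ν → ∀ t : ℝ, 0 < t →
    volume {x | ENNReal.ofReal t < maximal (fun B => ν B) x} ≤ A₁ * ν univ / ENNReal.ofReal t}

/-- `ρ` is a density function of the random variable `X` with respect to Lebesgue measure. -/
structure IsDensity {Ω : Type*} [MeasurableSpace Ω] {d : ℕ} (P : Measure Ω) (X : Ω → Eucl d)
    (ρ : Eucl d → ℝ) : Prop where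
  measurable : Measurable ρ
  nonneg : ∀ x, 0 ≤ ρ x
  map_eq : P.map X = volume.withDensity (fun x => ENNReal.ofReal (ρ x))

/-- The norm `‖f‖_∞`, the essential supremum of `|f|` with respect to Lebesgue measure. -/
def supNorm {d : ℕ} (f : Eucl d → ℝ) : ℝ≥0∞ := eLpNorm f ∞ volume

/-- The norm of `L^r(ℝ^d, ρ)`: it is `(∫ |f|^r ρ dx)^(1/r)` for finite `r`, and it is `‖f‖_∞`
(with respect to Lebesgue measure) for `r = ∞`. -/
def weightedNorm {d : ℕ} (r : ℝ≥0∞) (ρ f : Eucl d → ℝ) : ℝ≥0∞ :=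
  if r = ∞ then supNorm f
  else (∫⁻ x, ENNReal.ofReal |f x| ^ r.toReal * ENNReal.ofReal (ρ x)) ^ (1 / r.toReal)

/-- The constant `C_BV(p,q,r)`; here `m` stands for `E[|X - X'|^p]`, and `ρ`, `ρ'` for the
densities of `X` and `X'`. -/
def constBV {d : ℕ} (K₀ A₁ : ℝ≥0) (f ρ ρ' : Eucl d → ℝ) (m : ℝ≥0∞) (p q : ℝ) (r : ℝ≥0∞) :
    ℝ≥0∞ :=
  if r = ∞ then
    (2 * supNorm f) ^ (q - 1) *
      (2 ^ (p + 1) * (K₀ : ℝ≥0∞) ^ p * supNorm f +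
        A₁ * (supNorm ρ + supNorm ρ') * totalVariation f univ)
  else if m < 1 then
    2 ^ (q - 1) *
        (2 ^ (p + 1) * (K₀ : ℝ≥0∞) ^ p +
          A₁ * (supNorm ρ + supNorm ρ') * totalVariation f univ) +
      (weightedNorm r ρ f + weightedNorm r ρ' f) ^ r.toReal
  else
    (weightedNorm r ρ f + weightedNorm r ρ' f) ^ q

end Avikainen

end

namespace Avikainen

open Filter Topology Function
open scoped Pointwise

/-! ### Admissible fields, integration by parts, and the variation of smooth functions. -/

section TestFields

variable {d : ℕ}

/-! The core of (b) is the indicator of a set E of finite perimeter. The difference of its values at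
X and X' is 0 or 1, so raising a bound for it to the power p costs nothing. Where the maximal
function of the variation is at most l at both points, the pointwise estimate bounds the difference
by 2 K₀ l |X - X'|. The exceptional set has volume at most A₁ Per(E) / l, and the bounded densities
turn volume into probability. With m = E|X - X'|^p this gives l^p (2 K₀)^p m plus a multiple of
Per(E) / l (`lintegral_indicator_sub_le`), and l = m^(-1/(p+1)) makes both terms of order
m^(1/(p+1)).

A general f is reached through its superlevel sets. The layer-cake formula writes a truncated
difference as an integral over levels (`enorm_clip_sub_le`), and the coarea inequality bounds the
integral of the perimeters by the variation. Coarea is proved for smooth functions with integrable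
gradient (`exists_totalVariation_superlevel_le`). Mollification does not increase the variation
(`totalVariation_mollify_le`) and converges almost everywhere, so Fatou's lemma carries the
resulting estimate over to f (`lintegral_clip_sub_le`). Restricting the levels to [-lam, lam)
produces the term 2 lam (2 K₀)^p. For r = ∞, truncating at the essential supremum loses nothing. For
r < ∞ and m < 1, a truncation level that is a negative power of m balances the truncated part
against the tail, which Hölder and Chebyshev control (`setLIntegral_tail_le`). For m ≥ 1 the
triangle inequality in L^r suffices.

For (a), a Poincaré inequality on balls (`lintegral_prod_enorm_sub_le`) compares averages over a
ball and over smaller balls inside it. Telescoping along halved radii down to a Lebesgue point gives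
the pointwise bound, and the Vitali covering lemma gives the weak type bound. The latter applies to
the variation because `variationMeasure` agrees with a Borel measure on Borel sets
(`exists_measure_eq_variationMeasure`). -/

theorem continuous_divergence {g : Eucl d → Eucl d} (hg : ContDiff ℝ 1 g) :
    Continuous (divergence g) := by
  have h := hg.continuous_fderiv one_ne_zero
  unfold divergence
  fun_prop

theorem support_divergence_subset (g : Eucl d → Eucl d) :
    support (divergence g) ⊆ tsupport g := by
  intro x hx
  by_contra h
  refine hx ?_
  have : fderiv ℝ g x = 0 := by
    by_contra h0
    exact h (support_fderiv_subset ℝ h0)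
  simp [divergence, this]

theorem hasCompactSupport_divergence {g : Eucl d → Eucl d} (hg : HasCompactSupport g) :
    HasCompactSupport (divergence g) :=
  hg.mono' (support_divergence_subset g)

theorem integrable_mul_divergence {f : Eucl d → ℝ} (hf : LocallyIntegrable f volume)
    {g : Eucl d → Eucl d} (hg : ContDiff ℝ 1 g) (hgc : HasCompactSupport g) :
    Integrable (fun x => f x * divergence g x) := by
  have := hf.integrable_smul_right_of_hasCompactSupport (continuous_divergence hg)
    (hasCompactSupport_divergence hgc)
  simpa [mul_comm] using this

theorem setIntegral_mul_divergence {f : Eucl d → ℝ} {U : Set (Eucl d)} {g : Eucl d → Eucl d}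
    (hg : g ∈ testFields U) :
    ∫ x in U, f x * divergence g x = ∫ x, f x * divergence g x := by
  refine setIntegral_eq_integral_of_forall_compl_eq_zero fun x hx => ?_
  have : divergence g x = 0 := by
    by_contra h
    exact hx (hg.2.2.1 (support_divergence_subset g h))
  simp [this]

theorem totalVariation_eq (f : Eucl d → ℝ) (U : Set (Eucl d)) :
    totalVariation f U = ⨆ g ∈ testFields U, ENNReal.ofReal (∫ x, f x * divergence g x) :=
  iSup_congr fun _ => iSup_congr fun hg => by rw [setIntegral_mul_divergence hg]

theorem le_totalVariation {f : Eucl d → ℝ} {U : Set (Eucl d)} {g : Eucl d → Eucl d}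
    (hg : g ∈ testFields U) :
    ENNReal.ofReal (∫ x, f x * divergence g x) ≤ totalVariation f U := by
  rw [totalVariation_eq]
  exact le_iSup₂ (f := fun g (_ : g ∈ testFields U) =>
    ENNReal.ofReal (∫ x, f x * divergence g x)) g hg

theorem totalVariation_le {f : Eucl d → ℝ} {U : Set (Eucl d)} {C : ℝ≥0∞}
    (h : ∀ g ∈ testFields U, ENNReal.ofReal (∫ x, f x * divergence g x) ≤ C) :
    totalVariation f U ≤ C := by
  rw [totalVariation_eq]
  exact iSup₂_le h

theorem testFields_mono {U V : Set (Eucl d)} (h : U ⊆ V) : testFields U ⊆ testFields V :=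
  fun _ hg => ⟨hg.1, hg.2.1, hg.2.2.1.trans h, hg.2.2.2⟩

theorem totalVariation_mono (f : Eucl d → ℝ) {U V : Set (Eucl d)} (h : U ⊆ V) :
    totalVariation f U ≤ totalVariation f V :=
  totalVariation_le fun _ hg => le_totalVariation (testFields_mono h hg)

theorem totalVariation_empty (f : Eucl d → ℝ) : totalVariation f ∅ = 0 := by
  refine le_antisymm (totalVariation_le fun g hg => ?_) zero_le
  have : g = 0 := tsupport_eq_empty_iff.1 (subset_empty_iff.1 hg.2.2.1)
  subst this
  simp [divergence]

theorem variationMeasure_le_totalVariation (f : Eucl d → ℝ) {B V : Set (Eucl d)} (hV : IsOpen V)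
    (h : B ⊆ V) : variationMeasure f B ≤ totalVariation f V :=
  iInf_le_of_le V (iInf_le_of_le hV (iInf_le _ h))

theorem divergence_sum {ι : Type*} (s : Finset ι) {g : ι → Eucl d → Eucl d}
    (hg : ∀ i ∈ s, Differentiable ℝ (g i)) (x : Eucl d) :
    divergence (fun y => ∑ i ∈ s, g i y) x = ∑ i ∈ s, divergence (g i) x := by
  unfold divergence
  rw [Finset.sum_comm]
  refine Finset.sum_congr rfl fun j _ => ?_
  rw [fderiv_fun_sum fun i hi => (hg i hi) x]
  simp

theorem divergence_add {g g' : Eucl d → Eucl d} (hg : Differentiable ℝ g)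
    (hg' : Differentiable ℝ g') (x : Eucl d) :
    divergence (fun y => g y + g' y) x = divergence g x + divergence g' x := by
  unfold divergence
  rw [← Finset.sum_add_distrib]
  refine Finset.sum_congr rfl fun j _ => ?_
  rw [fderiv_fun_add (hg x) (hg' x), add_apply, PiLp.add_apply]

theorem testFields_smul {U V : Set (Eucl d)} {g : Eucl d → Eucl d} (hg : g ∈ testFields U)
    {χ : Eucl d → ℝ} (hχ : ContDiff ℝ 1 χ) (h1 : ∀ x, |χ x| ≤ 1) (hV : tsupport χ ⊆ V) :
    (fun x => χ x • g x) ∈ testFields V := by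
  refine ⟨hχ.smul hg.1, HasCompactSupport.smul_left (f := χ) hg.2.1, (tsupport_smul_subset_left χ g).trans hV, fun x => ?_⟩
  rw [norm_smul, Real.norm_eq_abs]
  exact mul_le_one₀ (h1 x) (norm_nonneg _) (hg.2.2.2 x)

/-- Integration by parts against a vector field with compact support. -/
theorem integral_mul_divergence {h : Eucl d → ℝ} (hh : ContDiff ℝ 1 h) {g : Eucl d → Eucl d}
    (hg : ContDiff ℝ 1 g) (hgc : HasCompactSupport g) :
    ∫ x, h x * divergence g x = -∫ x, fderiv ℝ h x (g x) := by
  have hcg : ∀ i : Fin d, ContDiff ℝ 1 fun x => g x i := fun i => by fun_prop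
  have hsg : ∀ i : Fin d, HasCompactSupport fun x => g x i := fun i =>
    hgc.comp_left (g := fun v : Eucl d => v i) (by simp)
  have hfd : ∀ (i : Fin d) x (v : Eucl d),
      fderiv ℝ (fun y => g y i) x v = fderiv ℝ g x v i := fun i x v => by
    have := ((EuclideanSpace.proj (𝕜 := ℝ) i).hasFDerivAt.comp x
      ((hg.differentiable one_ne_zero) x).hasFDerivAt).fderiv
    have h2 : fderiv ℝ (fun y => g y i) x
        = (EuclideanSpace.proj (𝕜 := ℝ) i).comp (fderiv ℝ g x) := this
    rw [h2]; rfl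
  have hdg : ∀ i : Fin d,
      Continuous fun x => fderiv ℝ (fun y => g y i) x (EuclideanSpace.single i 1) := fun i =>
    ((hcg i).continuous_fderiv one_ne_zero).clm_apply continuous_const
  have hdh : ∀ i : Fin d, Continuous fun x => fderiv ℝ h x (EuclideanSpace.single i 1) := fun i =>
    (hh.continuous_fderiv one_ne_zero).clm_apply continuous_const
  have hsdg : ∀ i : Fin d,
      HasCompactSupport fun x => fderiv ℝ (fun y => g y i) x (EuclideanSpace.single i 1) :=
    fun i => (hsg i).fderiv_apply ℝ _
  have key : ∀ i : Fin d, ∫ x, h x * fderiv ℝ (fun y => g y i) x (EuclideanSpace.single i 1)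
      = -∫ x, fderiv ℝ h x (EuclideanSpace.single i 1) * g x i := fun i =>
    integral_mul_fderiv_eq_neg_fderiv_mul_of_integrable
      (((hdh i).mul (hcg i).continuous).integrable_of_hasCompactSupport (hsg i).mul_left)
      ((hh.continuous.mul (hdg i)).integrable_of_hasCompactSupport (hsdg i).mul_left)
      ((hh.continuous.mul (hcg i).continuous).integrable_of_hasCompactSupport (hsg i).mul_left)
      (fun x _ => hh.differentiable one_ne_zero x)
      (fun x _ => (hcg i).differentiable one_ne_zero x)
  have e1 : ∀ x, h x * divergence g x
      = ∑ i, h x * fderiv ℝ (fun y => g y i) x (EuclideanSpace.single i 1) := fun x => by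
    rw [divergence, Finset.mul_sum]
    exact Finset.sum_congr rfl fun i _ => by rw [hfd]
  have e2 : ∀ x, fderiv ℝ h x (g x)
      = ∑ i, fderiv ℝ h x (EuclideanSpace.single i 1) * g x i := fun x => by
    have : g x = ∑ i, g x i • (EuclideanSpace.single i 1 : Eucl d) := by
      ext j
      simp [Finset.sum_apply, Pi.single_apply]
    conv_lhs => rw [this]
    rw [map_sum]
    exact Finset.sum_congr rfl fun i _ => by rw [map_smul, smul_eq_mul, mul_comm]
  simp_rw [e1, e2]
  rw [integral_finsetSum, integral_finsetSum, ← Finset.sum_neg_distrib]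
  · exact Finset.sum_congr rfl fun i _ => key i
  · exact fun i _ =>
      ((hdh i).mul (hcg i).continuous).integrable_of_hasCompactSupport (hsg i).mul_left
  · exact fun i _ =>
      (hh.continuous.mul (hdg i)).integrable_of_hasCompactSupport (hsdg i).mul_left

/-- A smooth cut-off function between a compact set and an open neighbourhood of it. -/
theorem exists_cutoff {K U : Set (Eucl d)} (hK : IsCompact K) (hU : IsOpen U) (hKU : K ⊆ U) :
    ∃ χ : Eucl d → ℝ, ContDiff ℝ 1 χ ∧ HasCompactSupport χ ∧ tsupport χ ⊆ U ∧
      (∀ x, 0 ≤ χ x ∧ χ x ≤ 1) ∧ ∀ x ∈ K, χ x = 1 := by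
  obtain ⟨L, hL, hKL, hLU⟩ := exists_compact_between hK hU hKU
  obtain ⟨χ, h1, h2, h3, h4⟩ := exists_contMDiff_support_eq_eq_one_iff (n := 1)
    (modelWithCornersSelf ℝ (Eucl d)) isOpen_interior hK.isClosed hKL
  have hsub : tsupport χ ⊆ L := by
    rw [tsupport, h3]
    exact closure_minimal interior_subset hL.isClosed
  exact ⟨χ, h1.contDiff, hL.of_isClosed_subset (isClosed_tsupport _) hsub, hsub.trans hLU,
    fun x => h2 (mem_range_self x), fun x hx => (h4 x).1 hx⟩

/-- The total variation of a smooth function dominates the integral of its gradient. -/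
theorem setLIntegral_fderiv_le_totalVariation {h : Eucl d → ℝ} (hh : ContDiff ℝ 2 h)
    {K U : Set (Eucl d)} (hK : IsCompact K) (hU : IsOpen U) (hKU : K ⊆ U) :
    ∫⁻ x in K, ‖fderiv ℝ h x‖ₑ ≤ totalVariation h U := by
  obtain ⟨χ, hχ, hχc, hχU, hχ01, hχ1⟩ := exists_cutoff hK hU hKU
  have hh1 : ContDiff ℝ 1 h := hh.of_le (by norm_num)
  have hD : ContDiff ℝ 1 (fderiv ℝ h) := hh.fderiv_right (by norm_num)
  have hgr : ContDiff ℝ 1 (gradient h) :=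
    (InnerProductSpace.toDual ℝ (Eucl d)).symm.contDiff.comp hD
  have hngr : ∀ x, ‖gradient h x‖ = ‖fderiv ℝ h x‖ := fun x => by simp [gradient]
  have hinner : ∀ x v, fderiv ℝ h x v = inner ℝ (gradient h x) v := fun x v => by
    simp [gradient]
  have hKfin : volume K ≠ ∞ := hK.measure_lt_top.ne
  have main : ∀ δ : ℝ, 0 < δ →
      ∫⁻ x in K, ‖fderiv ℝ h x‖ₑ ≤ totalVariation h U + ENNReal.ofReal δ * volume K := by
    intro δ hδ
    -- The optimal field is the normalised gradient, which is singular at critical points; δ smooths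
    -- the normalisation. The minus sign in `g` cancels the one from integration by parts.
    set w : Eucl d → ℝ := fun x => Real.sqrt (‖gradient h x‖ ^ 2 + δ ^ 2) with hw
    have hwpos : ∀ x, 0 < w x := fun x => Real.sqrt_pos.2 (by positivity)
    have hwc : ContDiff ℝ 1 w := by
      refine ContDiff.sqrt ((hgr.norm_sq ℝ).add contDiff_const) fun x => ?_
      positivity
    have hgw : ∀ x, ‖gradient h x‖ ≤ w x := fun x => by
      refine Real.le_sqrt_of_sq_le ?_
      nlinarith [sq_nonneg δ]
    have hwle : ∀ x, w x ≤ ‖gradient h x‖ + δ := fun x => by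
      rw [hw, Real.sqrt_le_left (by positivity)]
      nlinarith [norm_nonneg (gradient h x)]
    set g : Eucl d → Eucl d := fun x => (-(χ x * (w x)⁻¹)) • gradient h x with hg
    have hgC : ContDiff ℝ 1 g :=
      ((hχ.mul (hwc.inv fun x => (hwpos x).ne')).neg).smul hgr
    have hsupp : support g ⊆ support χ := fun x hx => by
      contrapose! hx
      simp [hg, notMem_support.1 hx]
    have hgt : g ∈ testFields U := by
      refine ⟨hgC, hχc.mono hsupp, (closure_mono hsupp).trans hχU, fun x => ?_⟩
      rw [hg, norm_smul, norm_neg, Real.norm_of_nonneg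
        (mul_nonneg (hχ01 x).1 (inv_nonneg.2 (hwpos x).le)), mul_assoc]
      refine mul_le_one₀ (hχ01 x).2 (mul_nonneg (inv_nonneg.2 (hwpos x).le) (norm_nonneg _)) ?_
      rw [inv_mul_le_one₀ (hwpos x)]
      exact hgw x
    have hval : ∀ x, -fderiv ℝ h x (g x) = χ x * ((w x)⁻¹ * ‖gradient h x‖ ^ 2) := fun x => by
      rw [hinner, hg, inner_smul_right, real_inner_self_eq_norm_sq]
      ring
    have hnn : ∀ x, 0 ≤ -fderiv ℝ h x (g x) := fun x => by
      rw [hval]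
      exact mul_nonneg (hχ01 x).1 (mul_nonneg (inv_nonneg.2 (hwpos x).le) (by positivity))
    have hint : Integrable fun x => -fderiv ℝ h x (g x) := by
      refine Continuous.integrable_of_hasCompactSupport
        (hD.continuous.clm_apply hgC.continuous).neg ((hχc.mono hsupp).mono ?_)
      intro x hx
      contrapose! hx
      simp [notMem_support.1 hx]
    have hlow : ∀ x ∈ K, ‖fderiv ℝ h x‖ₑ
        ≤ ENNReal.ofReal (-fderiv ℝ h x (g x)) + ENNReal.ofReal δ := fun x hx => by
      rw [← ENNReal.ofReal_add (hnn x) hδ.le, ← ofReal_norm]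
      refine ENNReal.ofReal_le_ofReal ?_
      rw [hval, hχ1 x hx, one_mul, ← hngr, inv_mul_eq_div, ← sub_le_iff_le_add,
        le_div_iff₀ (hwpos x)]
      -- With a the norm of the gradient, the claim is (a - δ) w ≤ a². The left side is nonpositive
      -- if a ≤ δ; otherwise w ≤ a + δ bounds it by a² - δ².
      rcases le_total ‖gradient h x‖ δ with hle | hle
      · nlinarith [hwpos x, norm_nonneg (gradient h x)]
      · nlinarith [hwle x]
    calc ∫⁻ x in K, ‖fderiv ℝ h x‖ₑ
        ≤ ∫⁻ x in K, (ENNReal.ofReal (-fderiv ℝ h x (g x)) + ENNReal.ofReal δ) :=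
          setLIntegral_mono' hK.measurableSet hlow
      _ = (∫⁻ x in K, ENNReal.ofReal (-fderiv ℝ h x (g x))) + ENNReal.ofReal δ * volume K := by
          rw [lintegral_add_right _ measurable_const, setLIntegral_const]
      _ ≤ (∫⁻ x, ENNReal.ofReal (-fderiv ℝ h x (g x))) + ENNReal.ofReal δ * volume K := by
          gcongr
          exact Measure.restrict_le_self
      _ = ENNReal.ofReal (∫ x, h x * divergence g x) + ENNReal.ofReal δ * volume K := by
          rw [← ofReal_integral_eq_lintegral_ofReal hint (ae_of_all _ hnn), integral_neg,
            integral_mul_divergence hh1 hgC hgt.2.1]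
      _ ≤ _ := by
          gcongr
          exact le_totalVariation hgt
  have hlim : Tendsto (fun δ : ℝ => totalVariation h U + ENNReal.ofReal δ * volume K) (𝓝[>] 0)
      (𝓝 (totalVariation h U + ENNReal.ofReal 0 * volume K)) := by
    refine Tendsto.const_add _ (ENNReal.Tendsto.mul_const ?_ (Or.inr hKfin))
    exact (ENNReal.continuous_ofReal.tendsto 0).mono_left nhdsWithin_le_nhds
  simp only [ENNReal.ofReal_zero, zero_mul, add_zero] at hlim
  exact ge_of_tendsto hlim (by filter_upwards [self_mem_nhdsWithin] with δ hδ using main δ hδ)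

theorem lintegral_fderiv_le_totalVariation {h : Eucl d → ℝ} (hh : ContDiff ℝ 2 h) :
    ∫⁻ x, ‖fderiv ℝ h x‖ₑ ≤ totalVariation h univ := by
  have hmono : Monotone fun n : ℕ => Metric.closedBall (0 : Eucl d) n := fun m n hmn =>
    Metric.closedBall_subset_closedBall (by exact_mod_cast hmn)
  rw [← setLIntegral_univ, ← Metric.iUnion_closedBall_nat (0 : Eucl d),
    setLIntegral_iUnion_of_directed _ hmono.directed_le]
  refine iSup_le fun n => ?_
  rw [Metric.iUnion_closedBall_nat]
  exact setLIntegral_fderiv_le_totalVariation hh (isCompact_closedBall _ _) isOpen_univ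
    (subset_univ _)

end TestFields

/-! ### Mollification: smoothness, control of the variation, almost everywhere convergence. -/

section Mollification

variable {d : ℕ}

/-- The mollification of `f` by a normed bump function. -/
noncomputable def mollify (φ : ContDiffBump (0 : Eucl d)) (f : Eucl d → ℝ) : Eucl d → ℝ :=
  convolution (φ.normed volume) f (ContinuousLinearMap.lsmul ℝ ℝ) volume

theorem mollify_apply (φ : ContDiffBump (0 : Eucl d)) (f : Eucl d → ℝ) (x : Eucl d) :
    mollify φ f x = ∫ y, φ.normed volume y * f (x - y) := rfl

theorem contDiff_mollify (φ : ContDiffBump (0 : Eucl d)) {f : Eucl d → ℝ}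
    (hf : LocallyIntegrable f volume) : ContDiff ℝ 2 (mollify φ f) :=
  HasCompactSupport.contDiff_convolution_left _ φ.hasCompactSupport_normed φ.contDiff_normed hf

theorem testFields_translate {U V : Set (Eucl d)} {g : Eucl d → Eucl d} (hg : g ∈ testFields U)
    (y : Eucl d) (h : ∀ x ∈ U, x - y ∈ V) : (fun z => g (z + y)) ∈ testFields V := by
  have he : (fun z => g (z + y)) = g ∘ Homeomorph.addRight y := rfl
  refine ⟨hg.1.comp (contDiff_id.add contDiff_const), ?_, ?_, fun x => hg.2.2.2 _⟩
  · rw [he]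
    exact hg.2.1.comp_homeomorph _
  · rw [he, tsupport_comp_eq_preimage]
    intro z hz
    simpa using h _ (hg.2.2.1 hz)

theorem divergence_translate (g : Eucl d → Eucl d) (y x : Eucl d) :
    divergence (fun z => g (z + y)) x = divergence g (x + y) := by
  unfold divergence
  simp_rw [fderiv_comp_add_right]

/-- By Fubini, pairing the mollified function with div g is a weighted average over y of pairings of
f with div of the translate of g by y. Each translate is admissible in V, and the weights have total
mass one. -/
theorem totalVariation_mollify_le (φ : ContDiffBump (0 : Eucl d)) {f : Eucl d → ℝ}
    (hf : LocallyIntegrable f volume) {U V : Set (Eucl d)}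
    (hUV : ∀ x ∈ U, ∀ y ∈ Metric.ball (0 : Eucl d) φ.rOut, x - y ∈ V) :
    totalVariation (mollify φ f) U ≤ totalVariation f V := by
  rcases eq_or_ne (totalVariation f V) ∞ with hT | hT
  · simp [hT]
  refine totalVariation_le fun g hg => ?_
  set ψ := φ.normed (volume : Measure (Eucl d)) with hψ
  have hψs : support ψ = Metric.ball 0 φ.rOut := φ.support_normed_eq
  -- All points x - y at which the double integrand can be nonzero lie in this compact set, so for
  -- Fubini f may be replaced by an integrable cut-off.
  set K : Set (Eucl d) := tsupport g + Metric.closedBall 0 φ.rOut with hK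
  have hKc : IsCompact K := hg.2.1.isCompact.add (isCompact_closedBall _ _)
  have hfK : Integrable (K.indicator f) :=
    (hf.integrableOn_isCompact hKc).integrable_indicator hKc.measurableSet
  have hψi : Integrable ψ := φ.integrable_normed
  have hdc := continuous_divergence hg.1
  obtain ⟨C, hC⟩ := hdc.bounded_above_of_compact_support (hasCompactSupport_divergence hg.2.1)
  have hF : Integrable (fun p : Eucl d × Eucl d => divergence g p.1 * (ψ p.2 * f (p.1 - p.2)))
      (volume.prod volume) := by
    have h1 := hψi.convolution_integrand (ContinuousLinearMap.lsmul ℝ ℝ) hfK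
    have h2 := h1.bdd_mul (c := C) (f := fun p : Eucl d × Eucl d => divergence g p.1)
      (hdc.comp continuous_fst).aestronglyMeasurable (ae_of_all _ fun p => hC _)
    refine h2.congr (ae_of_all _ fun p => ?_)
    simp only [ContinuousLinearMap.lsmul_apply, smul_eq_mul]
    by_cases h1 : divergence g p.1 = 0
    · simp [h1]
    by_cases h2 : ψ p.2 = 0
    · simp [h2]
    have : p.1 - p.2 ∈ K := by
      have h3 : p.2 ∈ Metric.ball (0 : Eucl d) φ.rOut := hψs ▸ h2
      rw [hK, sub_eq_add_neg]
      exact Set.add_mem_add (support_divergence_subset g h1)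
        (by simpa using (Metric.ball_subset_closedBall h3))
    rw [indicator_of_mem this]
  have e1 : ∫ x, mollify φ f x * divergence g x
      = ∫ y, ∫ x, divergence g x * (ψ y * f (x - y)) := by
    rw [← integral_integral_swap hF]
    refine integral_congr_ae (ae_of_all _ fun x => ?_)
    simp only
    rw [integral_const_mul, mul_comm, mollify_apply]
  have e2 : ∀ y, ∫ x, divergence g x * (ψ y * f (x - y))
      ≤ ψ y * (totalVariation f V).toReal := by
    intro y
    have : ∫ x, divergence g x * (ψ y * f (x - y))
        = ψ y * ∫ z, f z * divergence (fun z => g (z + y)) z := by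
      rw [← integral_const_mul,
        ← integral_sub_right_eq_self (fun z => ψ y * (f z * divergence (fun z => g (z + y)) z)) y]
      refine integral_congr_ae (ae_of_all _ fun x => ?_)
      simp only [divergence_translate, sub_add_cancel]
      ring
    rw [this]
    by_cases hy : ψ y = 0
    · simp [hy]
    refine mul_le_mul_of_nonneg_left ?_ (φ.nonneg_normed y)
    have hyb : y ∈ Metric.ball (0 : Eucl d) φ.rOut := hψs ▸ hy
    rw [← ENNReal.ofReal_le_iff_le_toReal hT]
    exact le_totalVariation (testFields_translate hg y fun x hx => hUV x hx y hyb)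
  have e3 : ∫ x, mollify φ f x * divergence g x ≤ (totalVariation f V).toReal := by
    calc ∫ x, mollify φ f x * divergence g x
        ≤ ∫ y, ψ y * (totalVariation f V).toReal := by
          rw [e1]
          exact integral_mono hF.integral_prod_right (hψi.mul_const _) e2
      _ = (totalVariation f V).toReal := by
          rw [integral_mul_const, φ.integral_normed, one_mul]
  exact (ENNReal.ofReal_le_iff_le_toReal hT).2 e3

/-- A sequence of bump functions shrinking to the origin. -/
noncomputable def bump (d : ℕ) (n : ℕ) : ContDiffBump (0 : Eucl d) where
  rIn := 1 / (n + 1)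
  rOut := 2 / (n + 1)
  rIn_pos := by positivity
  rIn_lt_rOut := by gcongr; norm_num

theorem tendsto_bump_rOut (d : ℕ) : Tendsto (fun n => (bump d n).rOut) atTop (𝓝 0) := by
  have := (tendsto_one_div_add_atTop_nhds_zero_nat (𝕜 := ℝ)).const_mul 2
  simp only [mul_zero] at this
  refine this.congr fun n => ?_
  simp [bump, div_eq_mul_inv]

theorem ae_tendsto_mollify {f : Eucl d → ℝ} (hf : LocallyIntegrable f volume) :
    ∀ᵐ x, Tendsto (fun n => mollify (bump d n) f x) atTop (𝓝 (f x)) := by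
  -- Convergence at Lebesgue points needs a bounded ratio of outer to inner radius; for `bump` the
  -- ratio is exactly 2.
  refine ContDiffBump.ae_convolution_tendsto_right_of_locallyIntegrable (K := 2)
    (tendsto_bump_rOut d) (Eventually.of_forall fun n => ?_) hf
  simp only [bump]
  apply le_of_eq
  ring

end Mollification

/-! ### The variation as a Borel measure. -/

section VariationMeasure

variable {d : ℕ}

/-- A partition of unity subordinate to the cover splits a test field into pieces admissible in the
individual sets. Local finiteness and compact support leave only finitely many nonzero pieces. -/
theorem totalVariation_iUnion_le {f : Eucl d → ℝ} (hf : LocallyIntegrable f volume)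
    {V : ℕ → Set (Eucl d)} (hV : ∀ i, IsOpen (V i)) :
    totalVariation f (⋃ i, V i) ≤ ∑' i, totalVariation f (V i) := by
  refine totalVariation_le fun g hg => ?_
  obtain ⟨ψ, hψ⟩ := SmoothPartitionOfUnity.exists_isSubordinate
    (modelWithCornersSelf ℝ (Eucl d)) (isClosed_tsupport g) V hV hg.2.2.1
  have hfin : {i | (support (ψ i) ∩ tsupport g).Nonempty}.Finite :=
    ψ.locallyFinite.finite_nonempty_inter_compact hg.2.1.isCompact
  set F := hfin.toFinset with hF
  have hC : ∀ i, ContDiff ℝ 1 (ψ i) := fun i => (ψ i).contMDiff.contDiff.of_le (by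
    exact_mod_cast le_top)
  have hmem : ∀ i, (fun x => ψ i x • g x) ∈ testFields (V i) := fun i =>
    testFields_smul hg (hC i) (fun x => abs_le.2 ⟨by linarith [ψ.nonneg i x], ψ.le_one i x⟩) (hψ i)
  have hsum : g = fun x => ∑ i ∈ F, ψ i x • g x := by
    funext x
    by_cases hx : x ∈ tsupport g
    · rw [← Finset.sum_smul]
      have h1 : ∑ᶠ i, ψ i x = 1 := ψ.sum_eq_one hx
      have h2 : ∑ᶠ i, ψ i x = ∑ i ∈ F, ψ i x := by
        refine finsum_eq_sum_of_support_subset _ fun i hi => ?_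
        simp only [hF, Finite.coe_toFinset, mem_ofPred_eq]
        exact ⟨x, hi, hx⟩
      rw [← h2, h1, one_smul]
    · simp [image_eq_zero_of_notMem_tsupport hx]
  have hdiv : ∀ x, divergence g x = ∑ i ∈ F, divergence (fun x => ψ i x • g x) x := fun x => by
    conv_lhs => rw [hsum]
    exact divergence_sum F (fun i _ => (hmem i).1.differentiable one_ne_zero) x
  calc ENNReal.ofReal (∫ x, f x * divergence g x)
      = ENNReal.ofReal (∑ i ∈ F, ∫ x, f x * divergence (fun x => ψ i x • g x) x) := by
        simp_rw [hdiv, Finset.mul_sum]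
        rw [integral_finsetSum]
        exact fun i _ => integrable_mul_divergence hf (hmem i).1 (hmem i).2.1
    _ ≤ ∑ i ∈ F, ENNReal.ofReal (∫ x, f x * divergence (fun x => ψ i x • g x) x) :=
        Finset.le_sum_of_subadditive _ ENNReal.ofReal_zero.le (fun _ _ => ENNReal.ofReal_add_le) _ _
    _ ≤ ∑ i ∈ F, totalVariation f (V i) := Finset.sum_le_sum fun i _ => le_totalVariation (hmem i)
    _ ≤ ∑' i, totalVariation f (V i) := ENNReal.sum_le_tsum F

/-- Fields supported in disjoint sets can be added without breaking the bound |g| ≤ 1. -/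
theorem totalVariation_add_le {f : Eucl d → ℝ} (hf : LocallyIntegrable f volume)
    {U V W : Set (Eucl d)} (hUW : U ⊆ W) (hVW : V ⊆ W) (hd : Disjoint U V) :
    totalVariation f U + totalVariation f V ≤ totalVariation f W := by
  rw [totalVariation_eq f U, totalVariation_eq f V]
  have h0 : ∀ S : Set (Eucl d), (0 : Eucl d → Eucl d) ∈ testFields S := fun S =>
    ⟨contDiff_const, HasCompactSupport.zero, by simp, by simp⟩
  refine ENNReal.biSup_add_biSup_le ⟨0, h0 U⟩ ⟨0, h0 V⟩ fun g hg g' hg' => ?_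
  have hmem : (fun x => g x + g' x) ∈ testFields W := by
    refine ⟨hg.1.add hg'.1, hg.2.1.add hg'.2.1, ?_, fun x => ?_⟩
    · exact (tsupport_add g g').trans
        (union_subset (hg.2.2.1.trans hUW) (hg'.2.2.1.trans hVW))
    · by_cases hx : x ∈ U
      · have : g' x = 0 := image_eq_zero_of_notMem_tsupport fun h =>
          disjoint_left.1 hd hx (hg'.2.2.1 h)
        simpa [this] using hg.2.2.2 x
      · have : g x = 0 := image_eq_zero_of_notMem_tsupport fun h => hx (hg.2.2.1 h)
        simpa [this] using hg'.2.2.2 x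
  have hadd : ∫ x, f x * divergence (fun x => g x + g' x) x
      = (∫ x, f x * divergence g x) + ∫ x, f x * divergence g' x := by
    rw [← integral_add (integrable_mul_divergence hf hg.1 hg.2.1)
      (integrable_mul_divergence hf hg'.1 hg'.2.1)]
    refine integral_congr_ae (ae_of_all _ fun x => ?_)
    simp only
    rw [divergence_add (hg.1.differentiable one_ne_zero) (hg'.1.differentiable one_ne_zero),
      mul_add]
  have hnn : ∀ {S : Set (Eucl d)} {k : Eucl d → Eucl d}, k ∈ testFields S → S ⊆ W →
      ENNReal.ofReal (∫ x, f x * divergence k x) ≤ totalVariation f W := fun hk hS =>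
    le_totalVariation (testFields_mono hS hk)
  -- `ENNReal.ofReal` is additive only on nonnegative numbers; a field with nonpositive pairing
  -- contributes zero and is dropped.
  rcases le_total (∫ x, f x * divergence g x) 0 with h1 | h1
  · rw [ENNReal.ofReal_of_nonpos h1, zero_add]
    exact hnn hg' hVW
  rcases le_total (∫ x, f x * divergence g' x) 0 with h2 | h2
  · rw [ENNReal.ofReal_of_nonpos h2, add_zero]
    exact hnn hg hUW
  rw [← ENNReal.ofReal_add h1 h2, ← hadd]
  exact le_totalVariation hmem

/-- The variation measure of a locally integrable function is a Borel measure. -/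
theorem exists_measure_eq_variationMeasure {f : Eucl d → ℝ} (hf : LocallyIntegrable f volume) :
    ∃ ν : Measure (Eucl d), ∀ B, MeasurableSet B → ν B = variationMeasure f B := by
  set m : ∀ U : Set (Eucl d), IsOpen U → ℝ≥0∞ := fun U _ => totalVariation f U with hm
  set μ : OuterMeasure (Eucl d) := inducedOuterMeasure m isOpen_empty (totalVariation_empty f)
    with hμ
  have hμv : ∀ B, μ B = variationMeasure f B := fun B =>
    inducedOuterMeasure_eq_iInf (m := m) (fun _ h => isOpen_iUnion h)
      (fun _ h => totalVariation_iUnion_le hf h) (fun _ _ _ _ h => totalVariation_mono f h) B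
  -- Carathéodory's criterion: additivity on sets at positive distance makes all Borel sets
  -- measurable. Such sets have disjoint open thickenings, to which superadditivity applies.
  have hmet : μ.IsMetric := by
    intro A B hAB
    refine le_antisymm (measure_union_le A B) ?_
    rw [hμv (A ∪ B)]
    refine le_iInf fun W => le_iInf fun hW => le_iInf fun hABW => ?_
    obtain ⟨r, hr0, hr⟩ := hAB
    obtain ⟨ε, hε, hεr⟩ : ∃ ε : ℝ, 0 < ε ∧ ENNReal.ofReal ε ≤ r := by
      rcases eq_or_ne r ∞ with h | h
      · exact ⟨1, one_pos, by simp [h]⟩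
      · exact ⟨r.toReal, ENNReal.toReal_pos hr0 h, ENNReal.ofReal_toReal_le⟩
    have hdisj : Disjoint (Metric.thickening (ε / 2) A) (Metric.thickening (ε / 2) B) := by
      refine disjoint_left.2 fun z hzA hzB => ?_
      obtain ⟨a, ha, hza⟩ := Metric.mem_thickening_iff.1 hzA
      obtain ⟨b, hb, hzb⟩ := Metric.mem_thickening_iff.1 hzB
      have h1 : ENNReal.ofReal ε ≤ edist a b := hεr.trans (hr a ha b hb)
      rw [edist_dist, ENNReal.ofReal_le_ofReal_iff dist_nonneg] at h1
      have := dist_triangle_left a b z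
      linarith
    rw [hμv A, hμv B]
    refine le_trans (add_le_add
      (variationMeasure_le_totalVariation f (hW.inter Metric.isOpen_thickening)
        (subset_inter (subset_union_left.trans hABW) (Metric.self_subset_thickening (half_pos hε) A)))
      (variationMeasure_le_totalVariation f (hW.inter Metric.isOpen_thickening)
        (subset_inter (subset_union_right.trans hABW)
          (Metric.self_subset_thickening (half_pos hε) B)))) ?_
    exact totalVariation_add_le hf inter_subset_left inter_subset_left
      (hdisj.mono inter_subset_right inter_subset_right)
  have hle : (inferInstance : MeasurableSpace (Eucl d)) ≤ μ.caratheodory := by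
    rw [BorelSpace.measurable_eq (α := Eucl d)]
    exact hmet.borel_le_caratheodory
  exact ⟨μ.toMeasure hle, fun B hB => by rw [toMeasure_apply μ hle hB, hμv]⟩

end VariationMeasure

/-! ### The Poincaré inequality on balls and the pointwise maximal estimate. -/

section Poincare

variable {d : ℕ}

/-- Convexity keeps the contracted set inside B, and the Jacobian factor t^(-d) is at most 2^d
because t ≥ 1/2. -/
theorem setLIntegral_homothety_le (u : Eucl d → ℝ≥0∞) (hu : Measurable u) {B : Set (Eucl d)}
    (hB : MeasurableSet B) (hBc : Convex ℝ B) {w : Eucl d} (hw : w ∈ B) {t : ℝ} (ht : 1 / 2 ≤ t)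
    (ht1 : t ≤ 1) :
    ∫⁻ z in B, u (w + t • (z - w)) ≤ 2 ^ d * ∫⁻ z in B, u z := by
  have ht0 : 0 < t := by linarith
  have hG : Measurable fun z => B.indicator u (z + (w - t • w)) :=
    (hu.indicator hB).comp (measurable_id.add_const _)
  calc ∫⁻ z in B, u (w + t • (z - w))
      ≤ ∫⁻ z, B.indicator u (t • z + (w - t • w)) := by
        rw [← lintegral_indicator hB]
        refine lintegral_mono fun z => ?_
        by_cases hz : z ∈ B
        · have h1 : t • z + (w - t • w) = w + t • (z - w) := by rw [smul_sub]; abel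
          have h2 : w + t • (z - w) ∈ B := hBc.add_smul_sub_mem hw hz ⟨ht0.le, ht1⟩
          rw [indicator_of_mem hz, h1, indicator_of_mem h2]
        · simp [hz]
    _ = ENNReal.ofReal |(t ^ d)⁻¹| * ∫⁻ z in B, u z := by
        have h := lintegral_map (μ := (volume : Measure (Eucl d))) hG (measurable_const_smul t)
        rw [← h, Measure.map_addHaar_smul _ ht0.ne', lintegral_smul_measure,
          lintegral_add_right_eq_self (B.indicator u), lintegral_indicator hB]
        simp
    _ ≤ 2 ^ d * ∫⁻ z in B, u z := by
        gcongr
        rw [abs_of_pos (by positivity), ← inv_pow, ENNReal.ofReal_pow (by positivity)]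
        gcongr
        rw [← ENNReal.ofReal_ofNat 2]
        refine ENNReal.ofReal_le_ofReal ?_
        rw [inv_le_comm₀ ht0 two_pos]
        linarith

theorem enorm_sub_le_lintegral_segment {h : Eucl d → ℝ} (hh : ContDiff ℝ 1 h) (w z : Eucl d) :
    ‖h z - h w‖ₑ ≤ ‖z - w‖ₑ * ∫⁻ t in Icc (0 : ℝ) 1, ‖fderiv ℝ h (w + t • (z - w))‖ₑ := by
  have hder : ∀ t ∈ uIcc (0 : ℝ) 1, HasDerivAt (fun t : ℝ => h (w + t • (z - w)))
      (fderiv ℝ h (w + t • (z - w)) (z - w)) t := fun t _ => by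
    have h1 : HasDerivAt (fun t : ℝ => w + t • (z - w)) (z - w) t := by
      simpa using ((hasDerivAt_id t).smul_const (z - w)).const_add w
    exact ((hh.differentiable one_ne_zero) _).hasFDerivAt.comp_hasDerivAt t h1
  have hc : Continuous fun t : ℝ => fderiv ℝ h (w + t • (z - w)) (z - w) :=
    ((hh.continuous_fderiv one_ne_zero).comp (by fun_prop)).clm_apply continuous_const
  have key := intervalIntegral.integral_eq_sub_of_hasDerivAt hder (hc.intervalIntegrable 0 1)
  simp only [one_smul, add_sub_cancel, zero_smul, add_zero] at key
  rw [← key, intervalIntegral.integral_of_le zero_le_one, ← integral_Icc_eq_integral_Ioc,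
    ← lintegral_const_mul' _ _ enorm_ne_top]
  refine (enorm_integral_le_lintegral_enorm _).trans (lintegral_mono fun t => ?_)
  rw [mul_comm]
  exact ContinuousLinearMap.le_opENorm _ _

/-- The Poincaré inequality on a ball, for smooth functions. -/
theorem lintegral_prod_enorm_sub_le_of_contDiff {h : Eucl d → ℝ} (hh : ContDiff ℝ 1 h)
    (c : Eucl d) (s : ℝ) :
    ∫⁻ p, ‖h p.1 - h p.2‖ₑ ∂((volume.restrict (Metric.closedBall c s)).prod
      (volume.restrict (Metric.closedBall c s))) ≤
      2 ^ (d + 1) * ENNReal.ofReal s * volume (Metric.closedBall c s) *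
        ∫⁻ x in Metric.closedBall c s, ‖fderiv ℝ h x‖ₑ := by
  set B := Metric.closedBall c s with hB
  have hBm : MeasurableSet B := Metric.isClosed_closedBall.measurableSet
  have hBc : Convex ℝ B := convex_closedBall c s
  set u : Eucl d → ℝ≥0∞ := fun x => ‖fderiv ℝ h x‖ₑ with hu
  have huc : Continuous u := (hh.continuous_fderiv one_ne_zero).enorm
  set μ := volume.restrict B with hμ
  have hmem : ∀ᵐ p ∂(μ.prod μ), p.1 ∈ B ∧ p.2 ∈ B := by
    have h1 : ∀ᵐ x ∂μ, x ∈ B := ae_restrict_mem hBm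
    exact (Measure.quasiMeasurePreserving_fst.ae h1).and (Measure.quasiMeasurePreserving_snd.ae h1)
  have hpt : ∀ᵐ p ∂(μ.prod μ), ‖h p.1 - h p.2‖ₑ ≤
      ENNReal.ofReal (2 * s) * ∫⁻ t in Icc (0 : ℝ) 1, u (p.2 + t • (p.1 - p.2)) := by
    filter_upwards [hmem] with p hp
    refine (enorm_sub_le_lintegral_segment hh p.2 p.1).trans ?_
    gcongr
    rw [← ofReal_norm]
    refine ENNReal.ofReal_le_ofReal ?_
    have h1 := Metric.mem_closedBall.1 hp.1
    have h2 := Metric.mem_closedBall.1 hp.2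
    rw [← dist_eq_norm]
    linarith [dist_triangle_right p.1 p.2 c]
  have hslice : ∀ t ∈ Icc (0 : ℝ) 1,
      ∫⁻ p, u (p.2 + t • (p.1 - p.2)) ∂(μ.prod μ) ≤ 2 ^ d * (∫⁻ x in B, u x) * volume B := by
    intro t ht
    have hm : Measurable fun p : Eucl d × Eucl d => u (p.2 + t • (p.1 - p.2)) :=
      (huc.comp (by fun_prop)).measurable
    have hconst : ∫⁻ _ : Eucl d, 2 ^ d * (∫⁻ x in B, u x) ∂μ
        = 2 ^ d * (∫⁻ x in B, u x) * volume B := by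
      rw [lintegral_const, hμ, Measure.restrict_apply_univ]
    rw [← hconst]
    -- The point on the segment has weight t on one endpoint and 1 - t on the other. Integrating
    -- first over the endpoint of weight at least 1/2 keeps the Jacobian bounded.
    rcases le_total (1 / 2) t with h12 | h12
    · rw [lintegral_prod_symm' _ hm]
      refine lintegral_mono_ae ?_
      filter_upwards [ae_restrict_mem hBm] with w hw
      exact setLIntegral_homothety_le u huc.measurable hBm hBc hw h12 ht.2
    · rw [lintegral_prod _ hm.aemeasurable]
      refine lintegral_mono_ae ?_
      filter_upwards [ae_restrict_mem hBm] with z hz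
      have := setLIntegral_homothety_le u huc.measurable hBm hBc hz (t := 1 - t) (by linarith)
        (by linarith [ht.1])
      refine le_trans (le_of_eq (lintegral_congr fun w => ?_)) this
      congr 1
      simp only [sub_smul, smul_sub, one_smul]
      abel
  calc ∫⁻ p, ‖h p.1 - h p.2‖ₑ ∂(μ.prod μ)
      ≤ ∫⁻ p, ENNReal.ofReal (2 * s) * (∫⁻ t in Icc (0 : ℝ) 1, u (p.2 + t • (p.1 - p.2)))
          ∂(μ.prod μ) := lintegral_mono_ae hpt
    _ = ENNReal.ofReal (2 * s) *
          ∫⁻ t in Icc (0 : ℝ) 1, (∫⁻ p, u (p.2 + t • (p.1 - p.2)) ∂(μ.prod μ)) := by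
        rw [lintegral_const_mul' _ _ ENNReal.ofReal_ne_top, lintegral_lintegral_swap]
        exact (huc.comp (by fun_prop)).measurable.aemeasurable
    _ ≤ ENNReal.ofReal (2 * s) *
          ∫⁻ _ in Icc (0 : ℝ) 1, 2 ^ d * (∫⁻ x in B, u x) * volume B := by
        refine mul_le_mul_right ?_ _
        exact setLIntegral_mono' measurableSet_Icc hslice
    _ = 2 ^ (d + 1) * ENNReal.ofReal s * volume B * ∫⁻ x in B, u x := by
        rw [setLIntegral_const, Real.volume_Icc, ENNReal.ofReal_mul zero_le_two]
        simp only [sub_zero, ENNReal.ofReal_one, mul_one, ENNReal.ofReal_ofNat]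
        ring

theorem lintegral_le_of_ae_tendsto {α : Type*} [MeasurableSpace α] {μ : Measure α}
    {F : ℕ → α → ℝ≥0∞} {f : α → ℝ≥0∞} {C : ℝ≥0∞} (hF : ∀ n, AEMeasurable (F n) μ)
    (hlim : ∀ᵐ x ∂μ, Tendsto (fun n => F n x) atTop (𝓝 (f x)))
    (hC : ∀ᶠ n in atTop, ∫⁻ x, F n x ∂μ ≤ C) : ∫⁻ x, f x ∂μ ≤ C := by
  calc ∫⁻ x, f x ∂μ = ∫⁻ x, liminf (fun n => F n x) atTop ∂μ :=
        lintegral_congr_ae (by filter_upwards [hlim] with x hx using hx.liminf_eq.symm)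
    _ ≤ liminf (fun n => ∫⁻ x, F n x ∂μ) atTop := lintegral_liminf_le' hF
    _ ≤ liminf (fun _ => C) (atTop : Filter ℕ) := liminf_le_liminf hC
    _ = C := liminf_const C

/-- The Poincaré inequality on a ball, for functions of locally bounded variation. -/
theorem lintegral_prod_enorm_sub_le {f : Eucl d → ℝ} (hf : LocallyIntegrable f volume)
    (c : Eucl d) (s : ℝ) :
    ∫⁻ p, ‖f p.1 - f p.2‖ₑ ∂((volume.restrict (Metric.closedBall c s)).prod
      (volume.restrict (Metric.closedBall c s))) ≤
      2 ^ (d + 1) * ENNReal.ofReal s * volume (Metric.closedBall c s) *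
        variationMeasure f (Metric.closedBall c s) := by
  set B := Metric.closedBall c s with hB
  set μ := volume.restrict B with hμ
  set C : ℝ≥0∞ := 2 ^ (d + 1) * ENNReal.ofReal s * volume B with hC
  have hCfin : C ≠ ∞ := ENNReal.mul_ne_top (ENNReal.mul_ne_top (by simp) ENNReal.ofReal_ne_top)
    (isCompact_closedBall c s).measure_lt_top.ne
  set h : ℕ → Eucl d → ℝ := fun n => mollify (bump d n) f with hh
  have hhc : ∀ n, ContDiff ℝ 2 (h n) := fun n => contDiff_mollify _ hf
  have hlim : ∀ᵐ p ∂(μ.prod μ),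
      Tendsto (fun n => ‖h n p.1 - h n p.2‖ₑ) atTop (𝓝 ‖f p.1 - f p.2‖ₑ) := by
    have h1 : ∀ᵐ x ∂μ, Tendsto (fun n => h n x) atTop (𝓝 (f x)) :=
      ae_restrict_of_ae (ae_tendsto_mollify hf)
    filter_upwards [Measure.quasiMeasurePreserving_fst.ae h1,
      Measure.quasiMeasurePreserving_snd.ae h1] with p hp1 hp2
    exact (hp1.sub hp2).enorm
  have main : ∀ V, IsOpen V → B ⊆ V →
      ∫⁻ p, ‖f p.1 - f p.2‖ₑ ∂(μ.prod μ) ≤ C * totalVariation f V := by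
    intro V hV hBV
    -- Half of the margin ε is spent on a neighbourhood of the ball carrying the test fields, the
    -- other half on the mollification radius.
    obtain ⟨ε, hε, hεV⟩ := (isCompact_closedBall c s).exists_thickening_subset_open hV hBV
    refine lintegral_le_of_ae_tendsto (fun n => ?_) hlim ?_
    · have := (hhc n).continuous
      exact (Continuous.enorm (by fun_prop)).measurable.aemeasurable
    · have hev := (tendsto_bump_rOut d).eventually_lt_const (half_pos hε)
      filter_upwards [hev] with n hn
      refine (lintegral_prod_enorm_sub_le_of_contDiff ((hhc n).of_le (by norm_num)) c s).trans ?_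
      refine mul_le_mul_right ((setLIntegral_fderiv_le_totalVariation (hhc n)
        (isCompact_closedBall c s) Metric.isOpen_thickening
        (Metric.self_subset_thickening (half_pos hε) _)).trans
        (totalVariation_mollify_le _ hf fun x hx y hy => hεV ?_)) _
      obtain ⟨z, hz, hxz⟩ := Metric.mem_thickening_iff.1 hx
      refine Metric.mem_thickening_iff.2 ⟨z, hz, ?_⟩
      have h1 : dist (x - y) x = ‖y‖ := by simp
      have h2 : ‖y‖ < (bump d n).rOut := by simpa using hy
      linarith [dist_triangle (x - y) x z]
  -- Passing to the infimum over V is done by dividing by C, which excludes the degenerate balls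
  -- with C = 0.
  rcases eq_or_ne C 0 with h0 | h0
  · simpa [h0] using main univ isOpen_univ (subset_univ _)
  · rw [← ENNReal.div_le_iff' h0 hCfin]
    exact le_iInf fun V => le_iInf fun hV => le_iInf fun hBV =>
      (ENNReal.div_le_iff' h0 hCfin).2 (main V hV hBV)

theorem edist_setAverage_le {f : Eucl d → ℝ} {E F : Set (Eucl d)} (hfE : IntegrableOn f E volume)
    (hfF : IntegrableOn f F volume) (hE0 : volume E ≠ 0) (hE : volume E ≠ ∞) (hF0 : volume F ≠ 0)
    (hF : volume F ≠ ∞) :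
    edist (⨍ x in E, f x) (⨍ x in F, f x) ≤ (volume E)⁻¹ * (volume F)⁻¹ *
      ∫⁻ p, ‖f p.1 - f p.2‖ₑ ∂((volume.restrict E).prod (volume.restrict F)) := by
  have : IsFiniteMeasure (volume.restrict E) := ⟨by simpa using hE.lt_top⟩
  have : IsFiniteMeasure (volume.restrict F) := ⟨by simpa using hF.lt_top⟩
  have hE' : 0 < volume.real E := ENNReal.toReal_pos hE0 hE
  have hF' : 0 < volume.real F := ENNReal.toReal_pos hF0 hF
  have hint : ∫ p, (f p.1 - f p.2) ∂((volume.restrict E).prod (volume.restrict F))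
      = volume.real F * (∫ x in E, f x) - volume.real E * ∫ x in F, f x := by
    rw [integral_sub (hfE.comp_fst _) (hfF.comp_snd _), integral_fun_fst, integral_fun_snd]
    simp
  have hsub : (⨍ x in E, f x) - (⨍ x in F, f x) = ((volume.real E)⁻¹ * (volume.real F)⁻¹) *
      ∫ p, (f p.1 - f p.2) ∂((volume.restrict E).prod (volume.restrict F)) := by
    rw [hint, setAverage_eq, setAverage_eq, smul_eq_mul, smul_eq_mul]
    field_simp
  rw [edist_eq_enorm_sub, hsub, enorm_mul, enorm_mul, enorm_inv hE'.ne', enorm_inv hF'.ne',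
    Real.enorm_of_nonneg hE'.le, Real.enorm_of_nonneg hF'.le, Measure.real, Measure.real,
    ENNReal.ofReal_toReal hE, ENNReal.ofReal_toReal hF]
  gcongr
  exact enorm_integral_le_lintegral_enorm _

theorem volume_closedBall_le (a c : Eucl d) {s s' : ℝ} (hs : 0 ≤ s) (h : s ≤ 2 * s') :
    volume (Metric.closedBall c s) ≤ 2 ^ d * volume (Metric.closedBall a s') := by
  rw [Measure.addHaar_closedBall _ _ hs, Measure.addHaar_closedBall _ _ (by linarith), ← mul_assoc]
  gcongr
  simp only [finrank_euclideanSpace, Fintype.card_fin]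
  rw [← ENNReal.ofReal_ofNat 2, ← ENNReal.ofReal_pow zero_le_two, ← ENNReal.ofReal_mul (by simp),
    ← mul_pow]
  exact ENNReal.ofReal_le_ofReal (pow_le_pow_left₀ hs h d)

/-- The difference of averages is an average of differences over a product of two balls, hence at
most the double integral over the larger ball divided by both volumes. Each volume is comparable to
that of the larger ball up to 2^d, which with the Poincaré factor 2^(d+1) gives 2^(3d+1). -/
theorem edist_setAverage_closedBall_le {f : Eucl d → ℝ} (hf : LocallyIntegrable f volume)
    {a b c : Eucl d} {s t s' : ℝ} (hs : 0 < s) (ht : s ≤ 2 * t) (hs' : s ≤ 2 * s')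
    (ha : Metric.closedBall a t ⊆ Metric.closedBall c s)
    (hb : Metric.closedBall b s' ⊆ Metric.closedBall c s) :
    edist (⨍ x in Metric.closedBall a t, f x) (⨍ x in Metric.closedBall b s', f x) ≤
      2 ^ (3 * d + 1) * ENNReal.ofReal s *
        (variationMeasure f (Metric.closedBall c s) / volume (Metric.closedBall c s)) := by
  have hpos : ∀ (x : Eucl d) {r : ℝ}, 0 < r → volume (Metric.closedBall x r) ≠ 0 := fun x r hr =>
    (Metric.measure_closedBall_pos _ x hr).ne'
  have hfin : ∀ (x : Eucl d) (r : ℝ), volume (Metric.closedBall x r) ≠ ∞ := fun x r =>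
    (isCompact_closedBall x r).measure_lt_top.ne
  have hint : ∀ (x : Eucl d) (r : ℝ), IntegrableOn f (Metric.closedBall x r) := fun x r =>
    hf.integrableOn_isCompact (isCompact_closedBall x r)
  have hinv : ∀ (x : Eucl d) {r : ℝ}, s ≤ 2 * r → (volume (Metric.closedBall x r))⁻¹ ≤
      2 ^ d * (volume (Metric.closedBall c s))⁻¹ := fun x r hr => by
    have h1 := ENNReal.inv_le_inv.2 (volume_closedBall_le x c hs.le hr)
    rw [ENNReal.mul_inv (by simp) (by simp)] at h1
    calc (volume (Metric.closedBall x r))⁻¹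
        = 2 ^ d * ((2 ^ d)⁻¹ * (volume (Metric.closedBall x r))⁻¹) := by
          rw [← mul_assoc, ENNReal.mul_inv_cancel (by simp) (by simp), one_mul]
      _ ≤ _ := by gcongr
  refine (edist_setAverage_le (hint a t) (hint b s') (hpos a (by linarith)) (hfin a t)
    (hpos b (by linarith)) (hfin b s')).trans ?_
  set v := volume (Metric.closedBall c s) with hv
  calc _ ≤ (2 ^ d * v⁻¹) * (2 ^ d * v⁻¹) *
        (2 ^ (d + 1) * ENNReal.ofReal s * v * variationMeasure f (Metric.closedBall c s)) := by
        refine mul_le_mul' (mul_le_mul' (hinv a ht) (hinv b hs')) ?_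
        refine le_trans (lintegral_mono' (Measure.prod_mono (Measure.restrict_mono_set _ ha)
          (Measure.restrict_mono_set _ hb)) le_rfl) (lintegral_prod_enorm_sub_le hf c s)
    _ = (v⁻¹ * v) * (2 ^ (3 * d + 1) * ENNReal.ofReal s *
        (variationMeasure f (Metric.closedBall c s) / v)) := by
        rw [ENNReal.div_eq_inv_mul]
        ring
    _ = _ := by rw [ENNReal.inv_mul_cancel (hpos c hs) (hfin c s), one_mul]

theorem le_restrictedMaximal {ν : Set (Eucl d) → ℝ≥0∞} {x : Eucl d} {s R : ℝ} (hs : 0 < s)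
    (hsR : s ≤ R) :
    ν (Metric.closedBall x s) / volume (Metric.closedBall x s) ≤ restrictedMaximal R ν x :=
  le_iSup_of_le s (le_iSup_of_le hs (le_iSup_of_le hsR le_rfl))

/-- At a point where the averages converge, the oscillation between the value and the average over
a ball is controlled by the maximal function. -/
theorem edist_setAverage_closedBall_self_le {f : Eucl d → ℝ} (hf : LocallyIntegrable f volume)
    {x : Eucl d} {r R : ℝ} (hr : 0 < r) (hrR : r ≤ R)
    (hx : Tendsto (fun k : ℕ => ⨍ y in Metric.closedBall x (r / 2 ^ k), f y) atTop (𝓝 (f x))) :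
    edist (⨍ y in Metric.closedBall x r, f y) (f x) ≤
      2 * (2 ^ (3 * d + 1) * ENNReal.ofReal r * restrictedMaximal R (variationMeasure f) x) := by
  -- Halving the radius halves the Poincaré bound, while the maximal function bounds the density at
  -- every scale; the increments form a geometric series.
  have h := edist_le_of_edist_le_geometric_two_of_tendsto₀
    (2 ^ (3 * d + 1) * ENNReal.ofReal r * restrictedMaximal R (variationMeasure f) x)
    (fun k => ?_) hx
  · simpa using h
  have hk : 0 < r / 2 ^ k := by positivity
  have hk1 : r / 2 ^ k = 2 * (r / 2 ^ (k + 1)) := by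
    rw [pow_succ]
    field_simp
  have hsub : r / 2 ^ (k + 1) ≤ r / 2 ^ k := by
    rw [hk1]
    have : 0 < r / 2 ^ (k + 1) := by positivity
    linarith
  refine (edist_setAverage_closedBall_le hf (c := x) hk (by linarith) hk1.le subset_rfl
    (Metric.closedBall_subset_closedBall hsub)).trans ?_
  have hle : r / 2 ^ k ≤ R := (div_le_self hr.le (one_le_pow₀ one_le_two)).trans hrR
  have h2 : ENNReal.ofReal (r / 2 ^ k) = ENNReal.ofReal r / 2 ^ k := by
    rw [ENNReal.ofReal_div_of_pos (by positivity), ENNReal.ofReal_pow zero_le_two,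
      ENNReal.ofReal_ofNat]
  calc _ ≤ 2 ^ (3 * d + 1) * ENNReal.ofReal (r / 2 ^ k) *
        restrictedMaximal R (variationMeasure f) x := by
        gcongr
        exact le_restrictedMaximal hk hle
    _ = _ := by
        rw [h2]
        simp only [div_eq_mul_inv]
        ring

theorem pointwiseConstants_nonempty (d : ℕ) : (pointwiseConstants d).Nonempty := by
  -- With C = 2^(3d+1), telescoping at x, telescoping at y and comparing the two averages cost 2C
  -- each. Two of these costs fall on x, so 4C serves both points.
  refine ⟨2 ^ (3 * d + 3), by positivity, fun f hf => ?_⟩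
  have hloc := hf.locallyIntegrable
  have hleb : ∀ᵐ z, ∀ r : ℝ, 0 < r →
      Tendsto (fun k : ℕ => ⨍ y in Metric.closedBall z (r / 2 ^ k), f y) atTop (𝓝 (f z)) := by
    filter_upwards [IsUnifLocDoublingMeasure.ae_tendsto_average
      (volume : Measure (Eucl d)) hloc 1] with z hz r hr
    refine hz (fun _ => z) (fun k : ℕ => r / 2 ^ k) ?_ (Eventually.of_forall fun k => ?_)
    · refine tendsto_nhdsWithin_iff.2 ⟨?_, Eventually.of_forall fun k => ?_⟩
      · have := (tendsto_pow_atTop_nhds_zero_of_lt_one (r := (1 / 2 : ℝ)) (by norm_num)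
          (by norm_num)).const_mul r
        simpa [div_eq_mul_inv] using this
      · exact div_pos hr (by positivity)
    · exact Metric.mem_closedBall_self (by positivity)
  obtain ⟨N, hN, hNm, hN0⟩ := exists_measurable_superset_of_null (ae_iff.1 hleb)
  refine ⟨N, hNm, hN0, fun x hx y hy => ?_⟩
  rcases eq_or_ne x y with rfl | hxy
  · simp
  have hlim : ∀ z ∉ N, ∀ r : ℝ, 0 < r →
      Tendsto (fun k : ℕ => ⨍ y in Metric.closedBall z (r / 2 ^ k), f y) atTop (𝓝 (f z)) :=
    fun z hz => not_not.1 fun h => hz (hN h)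
  set r := ‖x - y‖ with hr
  have hr0 : 0 < r := norm_pos_iff.2 (sub_ne_zero.2 hxy)
  set M := restrictedMaximal (2 * r) (variationMeasure f) with hM
  set C : ℝ≥0∞ := 2 ^ (3 * d + 1) with hC
  have h1 : edist (f x) (⨍ z in Metric.closedBall x r, f z) ≤ 2 * (C * ENNReal.ofReal r * M x) := by
    rw [edist_comm]
    exact edist_setAverage_closedBall_self_le hloc hr0 (by linarith) (hlim x hx r hr0)
  have h2 : edist (⨍ z in Metric.closedBall y r, f z) (f y) ≤ 2 * (C * ENNReal.ofReal r * M y) :=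
    edist_setAverage_closedBall_self_le hloc hr0 (by linarith) (hlim y hy r hr0)
  -- The ball of radius 2r about x contains both balls of radius r; this is the step that needs the
  -- range 2|x - y| in the maximal function.
  have h3 : edist (⨍ z in Metric.closedBall x r, f z) (⨍ z in Metric.closedBall y r, f z) ≤
      2 * (C * ENNReal.ofReal r * M x) := by
    refine (edist_setAverage_closedBall_le hloc (c := x) (s := 2 * r) (by linarith) le_rfl le_rfl
      (Metric.closedBall_subset_closedBall (by linarith))
      (Metric.closedBall_subset_closedBall' ?_)).trans ?_
    · rw [dist_comm, dist_eq_norm]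
      linarith
    · rw [ENNReal.ofReal_mul zero_le_two, ENNReal.ofReal_ofNat]
      refine (mul_le_mul_right (le_restrictedMaximal (R := 2 * r) (by linarith) le_rfl) _).trans
        (le_of_eq ?_)
      ring
  calc ENNReal.ofReal |f x - f y| = edist (f x) (f y) := by
        rw [edist_dist, Real.dist_eq]
    _ ≤ 2 * (C * ENNReal.ofReal r * M x) + 2 * (C * ENNReal.ofReal r * M x)
        + 2 * (C * ENNReal.ofReal r * M y) :=
        (edist_triangle4 _ _ _ _).trans (add_le_add (add_le_add h1 h3) h2)
    _ ≤ 2 * (C * ENNReal.ofReal r * M x) + 2 * (C * ENNReal.ofReal r * M x)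
        + (2 * (C * ENNReal.ofReal r * M y) + 2 * (C * ENNReal.ofReal r * M y)) := by
        gcongr
        exact le_self_add
    _ = _ := by
        push_cast
        rw [hC]
        ring

end Poincare

/-! ### The weak type bound for the maximal function. -/

section WeakType

variable {d : ℕ}

/-- Each point of the superlevel set is the centre of a ball of density at least t. A disjoint
Vitali subfamily covers the set after enlargement by 5, so the masses add up to at most the total
mass and the volumes grow by 5^d. -/
theorem weakTypeConstants_nonempty (hd : 0 < d) : (weakTypeConstants d).Nonempty := by
  refine ⟨5 ^ d, by positivity, fun ν hν t ht => ?_⟩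
  set S := {x : Eucl d | ENNReal.ofReal t < maximal (fun B => ν B) x} with hS
  have htpos : ENNReal.ofReal t ≠ 0 := by simpa using ht
  have hex : ∀ x ∈ S, ∃ s : ℝ, 0 < s ∧ ENNReal.ofReal t * volume (Metric.closedBall x s) ≤
      ν (Metric.closedBall x s) := by
    intro x hx
    simp only [hS, maximal, mem_ofPred_eq, lt_iSup_iff] at hx
    obtain ⟨s, hs, h⟩ := hx
    exact ⟨s, hs, (ENNReal.le_div_iff_mul_le
      (Or.inl (Metric.measure_closedBall_pos _ x hs).ne')
      (Or.inl (isCompact_closedBall x s).measure_lt_top.ne)).1 h.le⟩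
  choose! r hr0 hr using hex
  set v := volume (Metric.ball (0 : Eucl d) 1) with hv
  have hv0 : v ≠ 0 := (Metric.measure_ball_pos _ _ one_pos).ne'
  have hvfin : v ≠ ∞ := Metric.isBounded_ball.measure_lt_top.ne
  have hvol : ∀ (x : Eucl d) {s : ℝ}, 0 ≤ s →
      volume (Metric.closedBall x s) = ENNReal.ofReal (s ^ d) * v := fun x s hs => by
    rw [Measure.addHaar_closedBall _ _ hs]
    simp [hv]
  set L : ℝ := (ν univ / (ENNReal.ofReal t * v)).toReal with hL
  -- The covering lemma requires bounded radii. Finite total mass bounds the volume, hence (r x)^d,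
  -- which dominates r x when r x ≥ 1 and d > 0.
  have hbd : ∀ x ∈ S, r x ≤ max 1 L := by
    intro x hx
    rcases le_total (r x) 1 with h1 | h1
    · exact h1.trans (le_max_left _ _)
    refine le_trans ?_ (le_max_right _ _)
    have h2 := (hr x hx).trans (measure_mono (subset_univ _))
    rw [hvol x (hr0 x hx).le, mul_left_comm,
      ← ENNReal.le_div_iff_mul_le (Or.inl (mul_ne_zero htpos hv0))
        (Or.inl (ENNReal.mul_ne_top ENNReal.ofReal_ne_top hvfin)),
      ENNReal.ofReal_le_iff_le_toReal
        (ENNReal.div_ne_top (measure_ne_top _ _) (mul_ne_zero htpos hv0))] at h2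
    exact (le_self_pow₀ h1 hd.ne').trans h2
  obtain ⟨u, huS, hud, hcov⟩ := Vitali.exists_disjoint_subfamily_covering_enlargement_closedBall
    S id r (max 1 L) hbd 5 (by norm_num)
  have huc : u.Countable := hud.countable_of_nonempty_interior fun x hx => by
    rw [id, interior_closedBall _ (hr0 x (huS hx)).ne']
    exact Metric.nonempty_ball.2 (hr0 x (huS hx))
  have hsub : S ⊆ ⋃ b ∈ u, Metric.closedBall b (5 * r b) := fun x hx => by
    obtain ⟨b, hb, hxb⟩ := hcov x hx
    exact mem_biUnion hb (hxb (Metric.mem_closedBall_self (hr0 x hx).le))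
  rw [ENNReal.le_div_iff_mul_le (Or.inl htpos) (Or.inl ENNReal.ofReal_ne_top)]
  have : Countable u := huc.to_subtype
  calc volume S * ENNReal.ofReal t
      ≤ (∑' b : u, volume (Metric.closedBall (b : Eucl d) (5 * r b))) * ENNReal.ofReal t := by
        gcongr
        exact (measure_mono hsub).trans (measure_biUnion_le _ huc _)
    _ = ∑' b : u, 5 ^ d * (ENNReal.ofReal t * volume (Metric.closedBall (b : Eucl d) (r b))) := by
        rw [← ENNReal.tsum_mul_right]
        refine tsum_congr fun b => ?_
        have hb := (hr0 b (huS b.2)).le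
        rw [hvol _ hb, hvol _ (mul_nonneg (by norm_num) hb), mul_pow,
          ENNReal.ofReal_mul (by positivity), ENNReal.ofReal_pow (by norm_num),
          ENNReal.ofReal_ofNat]
        ring
    _ ≤ ∑' b : u, 5 ^ d * ν (Metric.closedBall (b : Eucl d) (r b)) := by
        gcongr with b
        exact hr b (huS b.2)
    _ = 5 ^ d * ν (⋃ b ∈ u, Metric.closedBall b (r b)) := by
        rw [ENNReal.tsum_mul_left, measure_biUnion (μ := ν)
          (f := fun b => Metric.closedBall b (r b)) huc hud fun b _ => Metric.isClosed_closedBall.measurableSet]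
    _ ≤ _ := by
        push_cast
        gcongr
        exact subset_univ _

end WeakType

/-! ### The coarea inequality for smooth functions. -/

section Coarea

variable {d : ℕ}

/-- A bump centred at 1/2 with outer radius 1/2 and a plateau of length 2a ≥ c; the bound 1/4 only
keeps a positive. Its primitive is a smooth step almost as high as it is wide and of slope at most
one. -/
theorem exists_bump_integral_ge {c : ℝ} (hc : c < 1) :
    ∃ ψ : ℝ → ℝ, Continuous ψ ∧ (∀ u, 0 ≤ ψ u ∧ ψ u ≤ 1) ∧ (∀ u ∉ Icc (0 : ℝ) 1, ψ u = 0) ∧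
      c ≤ ∫ u in (0 : ℝ)..1, ψ u := by
  set a : ℝ := max (1 / 4) (c / 2) with ha
  have ha0 : 0 < a := lt_of_lt_of_le (by norm_num) (le_max_left _ _)
  have ha1 : a < 1 / 2 := max_lt (by norm_num) (by linarith)
  set φ : ContDiffBump (1 / 2 : ℝ) := ⟨a, 1 / 2, ha0, ha1⟩ with hφ
  have h0 : ∀ u ∉ Icc (0 : ℝ) 1, φ u = 0 := fun u hu => by
    refine φ.zero_of_le_dist ?_
    by_contra! h
    rw [Real.dist_eq, abs_lt] at h
    simp only [hφ] at h
    exact hu ⟨by linarith, by linarith⟩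
  refine ⟨φ, φ.continuous, fun u => ⟨φ.nonneg, φ.le_one⟩, h0, ?_⟩
  rw [intervalIntegral.integral_of_le zero_le_one, ← integral_Icc_eq_integral_Ioc,
    setIntegral_eq_integral_of_forall_compl_eq_zero h0]
  refine le_trans ?_ (φ.measure_closedBall_le_integral volume)
  rw [Measure.real, Real.volume_closedBall, ENNReal.toReal_ofReal (by positivity)]
  linarith [le_max_right (1 / 4) (c / 2)]

/-- The measure on the line whose mass on an interval is the integral of the gradient of `h` over
the corresponding level strip. -/
noncomputable def levelMeasure (h : Eucl d → ℝ) : Measure ℝ :=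
  (volume.withDensity fun x => ‖fderiv ℝ h x‖ₑ).map h

theorem levelMeasure_apply {h : Eucl d → ℝ} (hh : ContDiff ℝ 1 h) {s : Set ℝ}
    (hs : MeasurableSet s) : levelMeasure h s = ∫⁻ x in h ⁻¹' s, ‖fderiv ℝ h x‖ₑ := by
  rw [levelMeasure, Measure.map_apply hh.continuous.measurable hs,
    withDensity_apply _ (hh.continuous.measurable hs)]

/-- The indicator of {h > t} is approximated by a smooth step of h across the strip t ≤ h ≤ y. After
integration by parts the gradient of the step lives on that strip and is at most |∇h| / (y - t), so
the pairing is bounded by the mean density of `levelMeasure` on [t, y]. Then y decreases to t. -/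
theorem integral_indicator_mul_divergence_le {h : Eucl d → ℝ} (hh : ContDiff ℝ 1 h) {t : ℝ}
    {D : ℝ≥0∞}
    (hD : Tendsto (fun y => levelMeasure h (Icc t y) / volume (Icc t y)) (𝓝[>] t) (𝓝 D))
    {g : Eucl d → Eucl d} (hg : g ∈ testFields univ) {c : ℝ} (hc : c < 1) (hc0 : 0 ≤ c) :
    ENNReal.ofReal (c * ∫ x, {x | t < h x}.indicator 1 x * divergence g x) ≤ D := by
  obtain ⟨ψ, hψc, hψ01, hψ0, hψint⟩ := exists_bump_integral_ge hc
  set η : ℝ → ℝ := fun u => ∫ v in (0 : ℝ)..u, ψ v with hη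
  have hηd : ∀ u, HasDerivAt η (ψ u) u := fun u => hψc.integral_hasStrictDerivAt 0 u |>.hasDerivAt
  have hηC : ContDiff ℝ 1 η := by
    rw [contDiff_one_iff_deriv]
    refine ⟨fun u => (hηd u).differentiableAt, ?_⟩
    rwa [show deriv η = ψ from funext fun u => (hηd u).deriv]
  set κ : ℝ := ∫ v in (0 : ℝ)..1, ψ v with hκ
  have hη0 : ∀ u ≤ 0, η u = 0 := fun u hu => by
    rw [hη]
    simp only
    rw [intervalIntegral.integral_symm, neg_eq_zero, intervalIntegral.integral_of_le hu,
      ← integral_Ico_eq_integral_Ioc]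
    refine setIntegral_eq_zero_of_forall_eq_zero fun v hv => hψ0 v fun h => ?_
    linarith [h.1, hv.2]
  have hη1 : ∀ u, 1 ≤ u → η u = κ := fun u hu => by
    rw [hη, hκ]
    simp only
    rw [← intervalIntegral.integral_add_adjacent_intervals (hψc.intervalIntegrable 0 1)
      (hψc.intervalIntegrable 1 u), add_eq_left, intervalIntegral.integral_of_le hu]
    refine setIntegral_eq_zero_of_forall_eq_zero fun v hv => hψ0 v fun h => ?_
    linarith [h.2, hv.1]
  have hmono : Monotone η := monotone_of_deriv_nonneg (fun u => (hηd u).differentiableAt)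
    fun u => by rw [(hηd u).deriv]; exact (hψ01 u).1
  have hηnn : ∀ u, 0 ≤ η u := fun u => by
    rcases le_total u 0 with h | h
    · exact (hη0 u h).ge
    · rw [← hη0 0 le_rfl]
      exact hmono h
  have hηle : ∀ u, η u ≤ κ := fun u => by
    rcases le_total u 1 with h | h
    · rw [← hη1 1 le_rfl]
      exact hmono h
    · exact (hη1 u h).le
  set I : ℝ := ∫ x, {x | t < h x}.indicator 1 x * divergence g x with hI
  set H : ℝ → Eucl d → ℝ := fun y x => η ((h x - t) / (y - t)) with hH
  have hHC : ∀ y, ContDiff ℝ 1 (H y) := fun y =>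
    hηC.comp ((hh.sub contDiff_const).div_const _)
  have hHd : ∀ y x, fderiv ℝ (H y) x = (ψ ((h x - t) / (y - t)) * (y - t)⁻¹) • fderiv ℝ h x := by
    intro y x
    have h1 : HasFDerivAt (fun x => (h x - t) / (y - t)) ((y - t)⁻¹ • fderiv ℝ h x) x := by
      have := (((hh.differentiable one_ne_zero) x).hasFDerivAt.sub_const t).const_mul (y - t)⁻¹
      simp_rw [div_eq_inv_mul]
      exact this
    rw [← smul_smul]
    exact ((hηd _).comp_hasFDerivAt x h1).fderiv
  have hgi : Integrable (divergence g) := (continuous_divergence hg.1).integrable_of_hasCompactSupport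
    (hasCompactSupport_divergence hg.2.1)
  -- the strips bound the regularised integrals
  have hbound : ∀ y, t < y → ENNReal.ofReal (∫ x, H y x * divergence g x) ≤
      levelMeasure h (Icc t y) / volume (Icc t y) := by
    intro y hy
    have hyt : 0 < y - t := sub_pos.2 hy
    rw [integral_mul_divergence (hHC y) hg.1 hg.2.1, ← integral_neg, levelMeasure_apply hh
      measurableSet_Icc, Real.volume_Icc, ENNReal.div_eq_inv_mul]
    refine (ENNReal.ofReal_le_ofReal (le_abs_self _)).trans ?_
    rw [← Real.norm_eq_abs, ofReal_norm]
    refine (enorm_integral_le_lintegral_enorm _).trans ?_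
    rw [← lintegral_indicator (hh.continuous.measurable measurableSet_Icc),
      ← lintegral_const_mul' _ _ (by simpa using hy)]
    refine lintegral_mono fun x => ?_
    simp only
    rw [hHd, smul_apply, enorm_neg, smul_eq_mul, enorm_mul, enorm_mul]
    by_cases hx : h x ∈ Icc t y
    · rw [indicator_of_mem (show x ∈ h ⁻¹' Icc t y from hx)]
      have h1 : ‖ψ ((h x - t) / (y - t))‖ₑ ≤ 1 := by
        rw [Real.enorm_of_nonneg (hψ01 _).1]
        simpa using (hψ01 _).2
      have h2 : ‖(y - t)⁻¹‖ₑ = (ENNReal.ofReal (y - t))⁻¹ := by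
        rw [enorm_inv hyt.ne', Real.enorm_of_nonneg hyt.le]
      have h3 : ‖fderiv ℝ h x (g x)‖ₑ ≤ ‖fderiv ℝ h x‖ₑ := by
        refine (ContinuousLinearMap.le_opENorm _ _).trans ?_
        have : ‖g x‖ₑ ≤ 1 := by
          rw [← ofReal_norm, ENNReal.ofReal_le_one]
          exact hg.2.2.2 x
        exact mul_le_of_le_one_right' this
      calc _ ≤ 1 * (ENNReal.ofReal (y - t))⁻¹ * ‖fderiv ℝ h x‖ₑ := by
            rw [h2]
            gcongr
        _ = _ := by rw [one_mul]
    · have : ψ ((h x - t) / (y - t)) = 0 := by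
        refine hψ0 _ fun h => hx ?_
        rw [mem_Icc, le_div_iff₀ hyt, div_le_iff₀ hyt] at h
        exact ⟨by linarith [h.1], by linarith [h.2]⟩
      simp [this]
  -- At each point x the step is eventually constant in y: equal to κ once y ≤ h x if h x > t, and
  -- to 0 if h x ≤ t.
  have hlim : Tendsto (fun y => ∫ x, H y x * divergence g x) (𝓝[>] t) (𝓝 (κ * I)) := by
    rw [hI, ← integral_const_mul]
    refine tendsto_integral_filter_of_dominated_convergence (fun x => κ * ‖divergence g x‖) ?_ ?_
      (hgi.norm.const_mul κ) (ae_of_all _ fun x => ?_)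
    · exact Eventually.of_forall fun y =>
        ((hHC y).continuous.mul (continuous_divergence hg.1)).aestronglyMeasurable
    · refine Eventually.of_forall fun y => ae_of_all _ fun x => ?_
      rw [norm_mul, Real.norm_of_nonneg (hηnn _)]
      gcongr
      exact hηle _
    · rw [← mul_assoc]
      refine Tendsto.mul_const _ ?_
      rcases lt_or_ge t (h x) with hx | hx
      · have : ∀ᶠ y in 𝓝[>] t, H y x = κ * {x | t < h x}.indicator 1 x := by
          filter_upwards [Ioc_mem_nhdsGT hx] with y hy
          rw [indicator_of_mem (show x ∈ {x | t < h x} from hx), Pi.one_apply, mul_one]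
          refine hη1 _ ?_
          rw [le_div_iff₀ (sub_pos.2 hy.1)]
          linarith [hy.2]
        exact tendsto_const_nhds.congr' (this.mono fun _ h => h.symm)
      · have : ∀ᶠ y in 𝓝[>] t, H y x = κ * {x | t < h x}.indicator 1 x := by
          filter_upwards [self_mem_nhdsWithin] with y hy
          rw [indicator_of_notMem (show x ∉ {x | t < h x} from not_lt.2 hx), mul_zero]
          exact hη0 _ (div_nonpos_of_nonpos_of_nonneg (by linarith) (sub_pos.2 hy).le)
        exact tendsto_const_nhds.congr' (this.mono fun _ h => h.symm)
  have hfinal : ENNReal.ofReal (κ * I) ≤ D :=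
    le_of_tendsto_of_tendsto ((ENNReal.continuous_ofReal.tendsto _).comp hlim) hD
      (by filter_upwards [self_mem_nhdsWithin] with y hy using hbound y hy)
  -- Replacing κ by the smaller c decreases the product only when I ≥ 0; otherwise the left side
  -- vanishes.
  rcases le_total I 0 with h0 | h0
  · rw [ENNReal.ofReal_of_nonpos (mul_nonpos_of_nonneg_of_nonpos hc0 h0)]
    exact zero_le
  · exact (ENNReal.ofReal_le_ofReal (mul_le_mul_of_nonneg_right hψint h0)).trans hfinal

/-- The coarea inequality for smooth functions. -/
theorem exists_totalVariation_superlevel_le {h : Eucl d → ℝ} (hh : ContDiff ℝ 1 h)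
    (hfin : ∫⁻ x, ‖fderiv ℝ h x‖ₑ ≠ ∞) :
    ∃ D : ℝ → ℝ≥0∞, Measurable D ∧ ∫⁻ t, D t ≤ ∫⁻ x, ‖fderiv ℝ h x‖ₑ ∧
      ∀ᵐ t, totalVariation ({x | t < h x}.indicator 1) univ ≤ D t := by
  have huniv : levelMeasure h univ = ∫⁻ x, ‖fderiv ℝ h x‖ₑ := by
    rw [levelMeasure_apply hh MeasurableSet.univ, preimage_univ, setLIntegral_univ]
  have : IsFiniteMeasure (levelMeasure h) := ⟨by rw [huniv]; exact hfin.lt_top⟩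
  -- The perimeter is bounded by the density of the absolutely continuous part of the level measure,
  -- whose integral is at most the total mass. Differentiation of measures makes this density the
  -- limit over one-sided intervals at almost every level.
  refine ⟨(levelMeasure h).rnDeriv volume, Measure.measurable_rnDeriv _ _,
    Measure.lintegral_rnDeriv_le.trans huniv.le, ?_⟩
  filter_upwards [VitaliFamily.ae_tendsto_rnDeriv
    (IsUnifLocDoublingMeasure.vitaliFamily (volume : Measure ℝ) 1) (levelMeasure h)] with t ht
  refine totalVariation_le fun g hg => ?_
  have hD := ht.comp (Real.tendsto_Icc_vitaliFamily_right t)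
  set I := ∫ x, {x | t < h x}.indicator 1 x * divergence g x
  have hc : Tendsto (fun c : ℝ => ENNReal.ofReal (c * I)) (𝓝[<] 1) (𝓝 (ENNReal.ofReal (1 * I))) :=
    (((ENNReal.continuous_ofReal.comp (continuous_mul_const I)).tendsto 1).mono_left
      nhdsWithin_le_nhds)
  rw [one_mul] at hc
  refine le_of_tendsto hc ?_
  filter_upwards [Ico_mem_nhdsLT (zero_lt_one' ℝ)] with c hc
  exact integral_indicator_mul_divergence_le hh hD hg hc.2 hc.1

end Coarea

/-! ### From indicator functions to truncated functions of bounded variation. -/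

section LevelSets

variable {d : ℕ} {Ω : Type*} [MeasurableSpace Ω] {P : Measure Ω} {X X' : Ω → Eucl d}
  {ρ ρ' : Eucl d → ℝ}

theorem IsDensity.measure_preimage_le (hX : Measurable X) (hρ : IsDensity P X ρ)
    {S : Set (Eucl d)} (hS : MeasurableSet S) : P (X ⁻¹' S) ≤ supNorm ρ * volume S := by
  rw [← Measure.map_apply hX hS, hρ.map_eq, withDensity_apply _ hS, ← setLIntegral_const]
  refine lintegral_mono_ae (ae_restrict_of_ae ?_)
  have h := ae_le_eLpNormEssSup (f := ρ) (μ := (volume : Measure (Eucl d)))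
  filter_upwards [h] with x hx
  rw [supNorm, eLpNorm_exponent_top, ← Real.enorm_of_nonneg (hρ.nonneg x)]
  exact hx

/-- Turns almost everywhere statements on the space into almost sure statements along X. -/
theorem IsDensity.quasiMeasurePreserving (hX : Measurable X) (hρ : IsDensity P X ρ) :
    Measure.QuasiMeasurePreserving X P volume :=
  ⟨hX, by rw [hρ.map_eq]; exact withDensity_absolutelyContinuous _ _⟩

theorem restrictedMaximal_le_maximal (R : ℝ) (ν : Set (Eucl d) → ℝ≥0∞) (x : Eucl d) :
    restrictedMaximal R ν x ≤ maximal ν x :=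
  iSup_le fun s => iSup_le fun hs => iSup_le fun _ => le_iSup_of_le s (le_iSup_of_le hs le_rfl)

theorem locallyIntegrable_indicator_one {E : Set (Eucl d)} (hE : MeasurableSet E) :
    LocallyIntegrable (E.indicator (1 : Eucl d → ℝ)) volume := by
  have h : LocallyIntegrable (1 : Eucl d → ℝ) volume := locallyIntegrable_const (1 : ℝ)
  exact h.indicator hE

/-- The estimate for the indicator function of a set of finite perimeter, at the truncation level
`l` of the maximal function. -/
theorem lintegral_indicator_sub_le {K₀ A₁ : ℝ≥0} (hK : K₀ ∈ pointwiseConstants d)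
    (hA : A₁ ∈ weakTypeConstants d) (hX : Measurable X) (hX' : Measurable X')
    (hρ : IsDensity P X ρ) (hρ' : IsDensity P X' ρ') {p : ℝ} (hp : 0 < p)
    {E : Set (Eucl d)} (hE : MeasurableSet E)
    (hTV : totalVariation (E.indicator 1) univ < ∞) {l : ℝ} (hl : 0 < l) :
    ∫⁻ ω, ‖E.indicator (1 : Eucl d → ℝ) (X ω) - E.indicator (1 : Eucl d → ℝ) (X' ω)‖ₑ ∂P ≤
      ENNReal.ofReal l ^ p * (2 * (K₀ : ℝ≥0∞)) ^ p * ∫⁻ ω, ENNReal.ofReal (‖X ω - X' ω‖ ^ p) ∂P +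
        A₁ * (supNorm ρ + supNorm ρ') * totalVariation (E.indicator 1) univ /
          ENNReal.ofReal l := by
  set g : Eucl d → ℝ := E.indicator 1 with hg
  have hloc : LocallyIntegrable g volume := locallyIntegrable_indicator_one hE
  obtain ⟨N, hNm, hN0, hN⟩ := hK.2 g
    ⟨hloc, fun V _ _ => (totalVariation_mono g (subset_univ V)).trans_lt hTV⟩
  obtain ⟨ν, hν⟩ := exists_measure_eq_variationMeasure hloc
  have hνuniv : ν univ ≤ totalVariation g univ := by
    rw [hν _ MeasurableSet.univ]
    exact variationMeasure_le_totalVariation g isOpen_univ subset_rfl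
  have hνfin : IsFiniteMeasure ν := ⟨hνuniv.trans_lt hTV⟩
  have hM : ∀ R x, restrictedMaximal R (variationMeasure g) x ≤ maximal (fun B => ν B) x := by
    intro R x
    refine (restrictedMaximal_le_maximal R _ x).trans (le_of_eq ?_)
    unfold maximal
    simp_rw [hν _ Metric.isClosed_closedBall.measurableSet]
  -- A measurable superset of the same volume avoids proving that the maximal function is
  -- measurable.
  set T := toMeasurable volume {x : Eucl d | ENNReal.ofReal l < maximal (fun B => ν B) x} with hT
  have hTm : MeasurableSet T := measurableSet_toMeasurable _ _
  have hTvol : volume T ≤ A₁ * totalVariation g univ / ENNReal.ofReal l := by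
    rw [hT, measure_toMeasurable]
    refine (hA.2 ν hνfin l hl).trans ?_
    gcongr
  have hTn : ∀ x ∉ T, maximal (fun B => ν B) x ≤ ENNReal.ofReal l := fun x hx =>
    not_lt.1 fun h => hx (subset_toMeasurable _ _ h)
  have hval : ∀ x y, ‖g x - g y‖ₑ = 0 ∨ ‖g x - g y‖ₑ = 1 := fun x y => by
    by_cases hx : x ∈ E <;> by_cases hy : y ∈ E <;> simp [hg, hx, hy]
  set W : Ω → ℝ≥0∞ := fun ω =>
    ENNReal.ofReal l ^ p * (2 * (K₀ : ℝ≥0∞)) ^ p * ENNReal.ofReal (‖X ω - X' ω‖ ^ p) with hW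
  have hpt : ∀ᵐ ω ∂P, ‖g (X ω) - g (X' ω)‖ₑ ≤
      W ω + ((X ⁻¹' T).indicator 1 ω + (X' ⁻¹' T).indicator 1 ω) := by
    have hNae : ∀ᵐ x : Eucl d, x ∉ N := measure_eq_zero_iff_ae_notMem.1 hN0
    filter_upwards [(hρ.quasiMeasurePreserving hX).ae hNae,
      (hρ'.quasiMeasurePreserving hX').ae hNae] with ω h1 h2
    rcases hval (X ω) (X' ω) with h | h
    · rw [h]
      exact zero_le
    by_cases hXT : X ω ∈ T
    · rw [h, indicator_of_mem (show ω ∈ X ⁻¹' T from hXT), Pi.one_apply]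
      exact le_add_left le_self_add
    by_cases hXT' : X' ω ∈ T
    · rw [h, indicator_of_mem (show ω ∈ X' ⁻¹' T from hXT'), Pi.one_apply]
      exact le_add_left le_add_self
    refine le_add_right ?_
    have h3 := hN (X ω) h1 (X' ω) h2
    rw [← Real.norm_eq_abs, ofReal_norm, h] at h3
    -- Here the two indicator values differ, so the left side of the pointwise estimate is exactly 1
    -- and any positive power of the right side still dominates it.
    have h4 : 1 ≤ ENNReal.ofReal l * (2 * (K₀ : ℝ≥0∞)) * ENNReal.ofReal ‖X ω - X' ω‖ := by
      refine h3.trans ?_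
      calc _ ≤ (K₀ : ℝ≥0∞) * ENNReal.ofReal ‖X ω - X' ω‖ *
            (ENNReal.ofReal l + ENNReal.ofReal l) := by
            gcongr
            · exact (hM _ _).trans (hTn _ hXT)
            · exact (hM _ _).trans (hTn _ hXT')
        _ = _ := by ring
    rw [h, hW]
    simp only
    rw [← ENNReal.ofReal_rpow_of_nonneg (norm_nonneg _) hp.le, ← ENNReal.mul_rpow_of_nonneg _ _ hp.le,
      ← ENNReal.mul_rpow_of_nonneg _ _ hp.le]
    exact ENNReal.one_le_rpow h4 hp
  have hdm : Measurable fun ω => ENNReal.ofReal (‖X ω - X' ω‖ ^ p) :=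
    ((hX.sub hX').norm.pow_const p).ennreal_ofReal
  have hWm : Measurable W := hdm.const_mul _
  calc ∫⁻ ω, ‖g (X ω) - g (X' ω)‖ₑ ∂P
      ≤ ∫⁻ ω, W ω + ((X ⁻¹' T).indicator 1 ω + (X' ⁻¹' T).indicator 1 ω) ∂P :=
        lintegral_mono_ae hpt
    _ = (∫⁻ ω, W ω ∂P) + (P (X ⁻¹' T) + P (X' ⁻¹' T)) := by
        rw [lintegral_add_left hWm, lintegral_add_left (measurable_one.indicator (hX hTm)),
          lintegral_indicator_one (hX hTm), lintegral_indicator_one (hX' hTm)]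
    _ ≤ (∫⁻ ω, W ω ∂P) + (supNorm ρ * (A₁ * totalVariation g univ / ENNReal.ofReal l) +
          supNorm ρ' * (A₁ * totalVariation g univ / ENNReal.ofReal l)) := by
        gcongr
        · exact (hρ.measure_preimage_le hX hTm).trans (by gcongr)
        · exact (hρ'.measure_preimage_le hX' hTm).trans (by gcongr)
    _ = _ := by
        rw [hW, lintegral_const_mul _ hdm]
        simp only [div_eq_mul_inv]
        ring

/-- Truncation of a real number at the levels `-lam` and `lam`. -/
def clip (lam u : ℝ) : ℝ := max (-lam) (min u lam)

theorem continuous_clip (lam : ℝ) : Continuous (clip lam) := by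
  unfold clip
  fun_prop

theorem abs_clip_le {lam : ℝ} (hlam : 0 ≤ lam) (u : ℝ) : |clip lam u| ≤ lam := by
  unfold clip
  rw [abs_le]
  exact ⟨le_max_left _ _, max_le (by linarith) (min_le_right _ _)⟩

theorem clip_of_abs_le {lam u : ℝ} (h : |u| ≤ lam) : clip lam u = u := by
  unfold clip
  rw [abs_le] at h
  rw [min_eq_left h.2, max_eq_right h.1]

/-- Layer cake: for b ≤ a the right side is the length of [b, a) ∩ [-lam, lam), to which the left
side is equal if lam ≥ 0. For negative lam the truncation is constant. -/
theorem enorm_clip_sub_le (lam a b : ℝ) :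
    ‖clip lam a - clip lam b‖ₑ ≤ ∫⁻ t in Ico (-lam) lam,
      ‖(Iio a).indicator (1 : ℝ → ℝ) t - (Iio b).indicator (1 : ℝ → ℝ) t‖ₑ := by
  wlog hab : b ≤ a generalizing a b
  · have := this b a (le_of_not_ge hab)
    rw [← enorm_neg, neg_sub]
    refine this.trans (le_of_eq (lintegral_congr fun t => ?_))
    rw [← enorm_neg, neg_sub]
  have h1 : ∀ t, ‖(Iio a).indicator (1 : ℝ → ℝ) t - (Iio b).indicator (1 : ℝ → ℝ) t‖ₑ =
      (Ico b a).indicator (1 : ℝ → ℝ≥0∞) t := fun t => by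
    by_cases ha : t < a <;> by_cases hb : t < b <;> simp [indicator, ha, hb]
    linarith
  simp_rw [h1]
  rw [lintegral_indicator_one measurableSet_Ico, Measure.restrict_apply measurableSet_Ico,
    Ico_inter_Ico, Real.volume_Ico, Real.enorm_eq_ofReal_abs]
  rcases le_total (clip lam a - clip lam b) 0 with h0 | h0
  · have hm : clip lam b ≤ clip lam a := by unfold clip; gcongr
    have : clip lam a - clip lam b = 0 := by linarith
    simp [this]
  · rw [abs_of_nonneg h0, ENNReal.ofReal_le_ofReal_iff']
    unfold clip
    grind

variable [IsProbabilityMeasure P]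

/-- The estimate for truncations of smooth functions, obtained by integrating over the levels. -/
theorem lintegral_clip_sub_le_of_contDiff {K₀ A₁ : ℝ≥0} (hK : K₀ ∈ pointwiseConstants d)
    (hA : A₁ ∈ weakTypeConstants d) (hX : Measurable X) (hX' : Measurable X')
    (hρ : IsDensity P X ρ) (hρ' : IsDensity P X' ρ') {p : ℝ} (hp : 0 < p)
    {h : Eucl d → ℝ} (hh : ContDiff ℝ 1 h) (hfin : ∫⁻ x, ‖fderiv ℝ h x‖ₑ ≠ ∞) (lam : ℝ)
    {m : ℝ≥0∞} (hm : m = ∫⁻ ω, ENNReal.ofReal (‖X ω - X' ω‖ ^ p) ∂P) (hm0 : m ≠ 0) (hmt : m ≠ ∞) :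
    ∫⁻ ω, ‖clip lam (h (X ω)) - clip lam (h (X' ω))‖ₑ ∂P ≤
      (ENNReal.ofReal (2 * lam) * (2 * (K₀ : ℝ≥0∞)) ^ p +
        A₁ * (supNorm ρ + supNorm ρ') * ∫⁻ x, ‖fderiv ℝ h x‖ₑ) * m ^ (1 / (p + 1)) := by
  obtain ⟨D, hDm, hDint, hD⟩ := exists_totalVariation_superlevel_le hh hfin
  have hp1 : 0 < p + 1 := by linarith
  -- The level for the maximal function solving Λ^p m = Λ⁻¹. It does not depend on t, so the
  -- estimate can be integrated over the levels.
  set Λ : ℝ≥0∞ := m ^ (-(1 / (p + 1))) with hΛ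
  have hΛ0 : Λ ≠ 0 := (ENNReal.rpow_pos (pos_iff_ne_zero.2 hm0) hmt).ne'
  have hΛt : Λ ≠ ∞ := ENNReal.rpow_ne_top_of_ne_zero hm0 hmt
  have hl : ENNReal.ofReal Λ.toReal = Λ := ENNReal.ofReal_toReal hΛt
  have e1 : Λ ^ p * m = m ^ (1 / (p + 1)) := by
    rw [hΛ, ← ENNReal.rpow_mul]
    nth_rewrite 2 [← ENNReal.rpow_one m]
    rw [← ENNReal.rpow_add _ _ hm0 hmt]
    congr 1
    field_simp
    ring
  have e2 : Λ⁻¹ = m ^ (1 / (p + 1)) := by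
    rw [hΛ, ENNReal.rpow_neg, inv_inv]
  set S := supNorm ρ + supNorm ρ'
  set c := m ^ (1 / (p + 1)) with hc
  set J : ℝ → Ω → ℝ≥0∞ := fun t ω => ‖{x | t < h x}.indicator (1 : Eucl d → ℝ) (X ω) -
    {x | t < h x}.indicator (1 : Eucl d → ℝ) (X' ω)‖ₑ with hJ
  have hlevel : ∀ᵐ t, ∫⁻ ω, J t ω ∂P ≤ (2 * (K₀ : ℝ≥0∞)) ^ p * c + A₁ * S * c * D t := by
    have hDfin : ∀ᵐ t, D t < ∞ := ae_lt_top hDm (hDint.trans_lt hfin.lt_top).ne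
    filter_upwards [hD, hDfin] with t ht ht'
    have hE : MeasurableSet {x | t < h x} := measurableSet_lt measurable_const
      hh.continuous.measurable
    refine (lintegral_indicator_sub_le hK hA hX hX' hρ hρ' hp hE (ht.trans_lt ht')
      (ENNReal.toReal_pos hΛ0 hΛt)).trans ?_
    rw [hl, ← hm, div_eq_mul_inv, e2, ← e1]
    calc _ ≤ Λ ^ p * (2 * (K₀ : ℝ≥0∞)) ^ p * m + A₁ * S * D t * (Λ ^ p * m) := by gcongr
      _ = _ := by ring
  have hset : ∀ Y : Ω → Eucl d, Measurable Y →
      Measurable fun z : Ω × ℝ => {x | z.2 < h x}.indicator (1 : Eucl d → ℝ) (Y z.1) := by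
    intro Y hY
    have : MeasurableSet {z : Ω × ℝ | z.2 < h (Y z.1)} :=
      measurableSet_lt measurable_snd (hh.continuous.measurable.comp (hY.comp measurable_fst))
    exact measurable_one.indicator this
  have hJm : Measurable fun z : Ω × ℝ => J z.2 z.1 := ((hset X hX).sub (hset X' hX')).enorm
  calc ∫⁻ ω, ‖clip lam (h (X ω)) - clip lam (h (X' ω))‖ₑ ∂P
      ≤ ∫⁻ ω, (∫⁻ t in Ico (-lam) lam, J t ω) ∂P :=
        lintegral_mono fun ω => enorm_clip_sub_le lam _ _
    _ = ∫⁻ t in Ico (-lam) lam, (∫⁻ ω, J t ω ∂P) :=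
        lintegral_lintegral_swap hJm.aemeasurable
    _ ≤ ∫⁻ t in Ico (-lam) lam, ((2 * (K₀ : ℝ≥0∞)) ^ p * c + A₁ * S * c * D t) :=
        lintegral_mono_ae (ae_restrict_of_ae hlevel)
    _ = (2 * (K₀ : ℝ≥0∞)) ^ p * c * ENNReal.ofReal (2 * lam) +
          A₁ * S * c * ∫⁻ t in Ico (-lam) lam, D t := by
        rw [lintegral_add_left measurable_const, setLIntegral_const, Real.volume_Ico,
          lintegral_const_mul _ hDm]
        congr 3
        ring
    _ ≤ (2 * (K₀ : ℝ≥0∞)) ^ p * c * ENNReal.ofReal (2 * lam) +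
          A₁ * S * c * ∫⁻ x, ‖fderiv ℝ h x‖ₑ := by
        gcongr
        exact (setLIntegral_le_lintegral _ _).trans hDint
    _ = _ := by ring

/-- The estimate for truncations of functions of bounded variation. -/
theorem lintegral_clip_sub_le {K₀ A₁ : ℝ≥0} (hK : K₀ ∈ pointwiseConstants d)
    (hA : A₁ ∈ weakTypeConstants d) (hX : Measurable X) (hX' : Measurable X')
    (hρ : IsDensity P X ρ) (hρ' : IsDensity P X' ρ') {p : ℝ} (hp : 0 < p)
    {f : Eucl d → ℝ} (hf : IsBV f) (lam : ℝ)
    {m : ℝ≥0∞} (hm : m = ∫⁻ ω, ENNReal.ofReal (‖X ω - X' ω‖ ^ p) ∂P) (hm0 : m ≠ 0) (hmt : m ≠ ∞) :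
    ∫⁻ ω, ‖clip lam (f (X ω)) - clip lam (f (X' ω))‖ₑ ∂P ≤
      (ENNReal.ofReal (2 * lam) * (2 * (K₀ : ℝ≥0∞)) ^ p +
        A₁ * (supNorm ρ + supNorm ρ') * totalVariation f univ) * m ^ (1 / (p + 1)) := by
  have hloc := hf.integrable.locallyIntegrable
  set h : ℕ → Eucl d → ℝ := fun n => mollify (bump d n) f with hh
  have hhc : ∀ n, ContDiff ℝ 2 (h n) := fun n => contDiff_mollify _ hloc
  have hlim := ae_tendsto_mollify hloc
  have hTV : ∀ n, ∫⁻ x, ‖fderiv ℝ (h n) x‖ₑ ≤ totalVariation f univ := fun n =>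
    (lintegral_fderiv_le_totalVariation (hhc n)).trans
      (totalVariation_mollify_le _ hloc fun _ _ _ _ => mem_univ _)
  refine lintegral_le_of_ae_tendsto
    (F := fun n ω => ‖clip lam (h n (X ω)) - clip lam (h n (X' ω))‖ₑ) (fun n => ?_) ?_
    (Eventually.of_forall fun n => ?_)
  · have hc := ((continuous_clip lam).comp (hhc n).continuous).measurable
    exact ((hc.comp hX).sub (hc.comp hX')).enorm.aemeasurable
  · filter_upwards [(hρ.quasiMeasurePreserving hX).ae hlim,
      (hρ'.quasiMeasurePreserving hX').ae hlim] with ω h1 h2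
    exact ((((continuous_clip lam).tendsto _).comp h1).sub
      (((continuous_clip lam).tendsto _).comp h2)).enorm
  · refine (lintegral_clip_sub_le_of_contDiff hK hA hX hX' hρ hρ' hp ((hhc n).of_le (by norm_num))
      ((hTV n).trans_lt hf.totalVariation_lt_top).ne lam hm hm0 hmt).trans ?_
    gcongr
    exact hTV n

end LevelSets

/-! ### Moment inequalities: interpolation, Hölder and Chebyshev. -/

section Moments

variable {d : ℕ} {Ω : Type*} [MeasurableSpace Ω] {P : Measure Ω} {X X' : Ω → Eucl d}
  {ρ ρ' : Eucl d → ℝ}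

/-- Change of variables along X, so that the moment inequalities can be applied under P. -/
theorem IsDensity.weightedNorm_eq_eLpNorm (hX : Measurable X) (hρ : IsDensity P X ρ)
    {f : Eucl d → ℝ} (hf : AEStronglyMeasurable f volume) {r : ℝ≥0∞} (hr0 : r ≠ 0) (hr : r ≠ ∞) :
    weightedNorm r ρ f = eLpNorm (fun ω => f (X ω)) r P := by
  rw [weightedNorm, if_neg hr, eLpNorm_eq_lintegral_rpow_enorm_toReal hr0 hr]
  congr 1
  have hfm : AEMeasurable (fun x => ‖f x‖ₑ ^ r.toReal) (volume : Measure (Eucl d)) :=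
    hf.enorm.pow_const _
  have hac : P.map X ≪ volume := (hρ.quasiMeasurePreserving hX).absolutelyContinuous
  have h1 := lintegral_map' (f := fun x => ‖f x‖ₑ ^ r.toReal) (hfm.mono_ac hac) hX.aemeasurable
  rw [← h1, hρ.map_eq, lintegral_withDensity_eq_lintegral_mul₀
    hρ.measurable.ennreal_ofReal.aemeasurable hfm]
  refine lintegral_congr fun x => ?_
  rw [Pi.mul_apply, mul_comm, ← Real.enorm_eq_ofReal_abs]

theorem lintegral_enorm_rpow_le_of_bounded {V : Ω → ℝ} {L : ℝ≥0∞} {q : ℝ} (hq : 1 ≤ q)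
    (hL : L ≠ ∞) (hV : ∀ᵐ ω ∂P, ‖V ω‖ₑ ≤ L) :
    ∫⁻ ω, ‖V ω‖ₑ ^ q ∂P ≤ L ^ (q - 1) * ∫⁻ ω, ‖V ω‖ₑ ∂P := by
  rw [← lintegral_const_mul' _ _ (ENNReal.rpow_ne_top_of_nonneg (by linarith) hL)]
  refine lintegral_mono_ae ?_
  filter_upwards [hV] with ω hω
  calc ‖V ω‖ₑ ^ q = ‖V ω‖ₑ ^ (q - 1) * ‖V ω‖ₑ := by
        nth_rewrite 3 [← ENNReal.rpow_one ‖V ω‖ₑ]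
        rw [← ENNReal.rpow_add_of_nonneg _ _ (by linarith) zero_le_one]
        congr 1
        ring
    _ ≤ L ^ (q - 1) * ‖V ω‖ₑ := by
        gcongr

theorem lintegral_enorm_rpow_eq_eLpNorm_rpow (V : Ω → ℝ) (μ : Measure Ω) {q : ℝ} (hq : 0 < q) :
    ∫⁻ ω, ‖V ω‖ₑ ^ q ∂μ = eLpNorm V (ENNReal.ofReal q) μ ^ q := by
  rw [eLpNorm_eq_lintegral_rpow_enorm_toReal (by simpa using hq) ENNReal.ofReal_ne_top,
    ENNReal.toReal_ofReal hq.le, ← ENNReal.rpow_mul, one_div, inv_mul_cancel₀ hq.ne',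
    ENNReal.rpow_one]

/-- Hölder's inequality on a set. -/
theorem setLIntegral_enorm_rpow_le {V : Ω → ℝ} (hV : AEStronglyMeasurable V P) (A : Set Ω)
    {q s : ℝ} (hq : 0 < q) (hqs : q ≤ s) :
    ∫⁻ ω in A, ‖V ω‖ₑ ^ q ∂P ≤ eLpNorm V (ENNReal.ofReal s) P ^ q * P A ^ (1 - q / s) := by
  have hs : 0 < s := hq.trans_le hqs
  rw [lintegral_enorm_rpow_eq_eLpNorm_rpow V _ hq]
  have h := eLpNorm_le_eLpNorm_mul_rpow_measure_univ (ENNReal.ofReal_le_ofReal hqs)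
    (hV.mono_measure (Measure.restrict_le_self (s := A)))
  rw [ENNReal.toReal_ofReal hq.le, ENNReal.toReal_ofReal hs.le, Measure.restrict_apply_univ] at h
  calc _ ≤ (eLpNorm V (ENNReal.ofReal s) (P.restrict A) * P A ^ (1 / q - 1 / s)) ^ q := by gcongr
    _ ≤ (eLpNorm V (ENNReal.ofReal s) P * P A ^ (1 / q - 1 / s)) ^ q := by
        gcongr
        exact Measure.restrict_le_self
    _ = _ := by
        rw [ENNReal.mul_rpow_of_nonneg _ _ hq.le, ← ENNReal.rpow_mul]
        congr 2
        field_simp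

theorem measure_lt_enorm_le {Y : Ω → ℝ} (hY : AEStronglyMeasurable Y P) {s : ℝ} (hs : 0 < s)
    {L : ℝ≥0∞} (hL : L ≠ 0) (hLt : L ≠ ∞) :
    P {ω | L < ‖Y ω‖ₑ} ≤ eLpNorm Y (ENNReal.ofReal s) P ^ s * L⁻¹ ^ s := by
  have h := meas_ge_le_mul_pow_eLpNorm_enorm P (p := ENNReal.ofReal s) (by simpa using hs)
    ENNReal.ofReal_ne_top hY hL (fun h => absurd h hLt)
  rw [ENNReal.toReal_ofReal hs.le, mul_comm] at h
  exact (measure_mono fun ω (hω : L < ‖Y ω‖ₑ) => hω.le).trans h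

/-- The part of a difference that is lost by truncation at the level `L`. -/
theorem setLIntegral_tail_le {Y Y' : Ω → ℝ} (hY : AEStronglyMeasurable Y P)
    (hY' : AEStronglyMeasurable Y' P) {q s : ℝ} (hq : 0 < q) (hqs : q ≤ s) (hs1 : 1 ≤ s)
    {L : ℝ≥0∞} (hL : L ≠ 0) (hLt : L ≠ ∞) :
    ∫⁻ ω in {ω | L < ‖Y ω‖ₑ} ∪ {ω | L < ‖Y' ω‖ₑ}, ‖Y ω - Y' ω‖ₑ ^ q ∂P ≤
      (eLpNorm Y (ENNReal.ofReal s) P + eLpNorm Y' (ENNReal.ofReal s) P) ^ s * L ^ (q - s) := by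
  have hs : 0 < s := hq.trans_le hqs
  set a := eLpNorm Y (ENNReal.ofReal s) P with ha
  set b := eLpNorm Y' (ENNReal.ofReal s) P with hb
  set A : Set Ω := {ω | L < ‖Y ω‖ₑ} ∪ {ω | L < ‖Y' ω‖ₑ} with hA
  have hexp : 0 ≤ 1 - q / s := by
    rw [sub_nonneg, div_le_one hs]
    exact hqs
  have hPA : P A ≤ (a + b) ^ s * L⁻¹ ^ s := by
    calc P A ≤ a ^ s * L⁻¹ ^ s + b ^ s * L⁻¹ ^ s :=
          (measure_union_le _ _).trans (add_le_add (measure_lt_enorm_le hY hs hL hLt)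
            (measure_lt_enorm_le hY' hs hL hLt))
      _ = (a ^ s + b ^ s) * L⁻¹ ^ s := by ring
      _ ≤ _ := by
          gcongr
          exact ENNReal.add_rpow_le_rpow_add a b hs1
  have hsub : eLpNorm (fun ω => Y ω - Y' ω) (ENNReal.ofReal s) P ≤ a + b :=
    eLpNorm_sub_le hY hY' (by simpa using hs1)
  have e1 : s * (1 - q / s) = s - q := by field_simp
  -- Hölder on the exceptional set, then Chebyshev for its probability. The powers of a + b add up
  -- to q + s (1 - q/s) = s.
  calc _ ≤ eLpNorm (fun ω => Y ω - Y' ω) (ENNReal.ofReal s) P ^ q * P A ^ (1 - q / s) :=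
        setLIntegral_enorm_rpow_le (hY.sub hY') A hq hqs
    _ ≤ (a + b) ^ q * ((a + b) ^ s * L⁻¹ ^ s) ^ (1 - q / s) := by gcongr
    _ = ((a + b) ^ q * (a + b) ^ (s - q)) * L⁻¹ ^ (s - q) := by
        rw [ENNReal.mul_rpow_of_nonneg _ _ hexp, ← ENNReal.rpow_mul, ← ENNReal.rpow_mul, e1,
          mul_assoc]
    _ = (a + b) ^ s * L ^ (q - s) := by
        rw [← ENNReal.rpow_add_of_nonneg _ _ hq.le (by linarith), ENNReal.inv_rpow,
          ← ENNReal.rpow_neg]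
        congr 2 <;> ring

end Moments

/-! ### Choice of the truncation level and the final estimates. -/

section Main

variable {d : ℕ} {Ω : Type*} [MeasurableSpace Ω] {P : Measure Ω} {X X' : Ω → Eucl d}
  {ρ ρ' : Eucl d → ℝ}

theorem constBV_lt_top (K₀ A₁ : ℝ≥0) {f : Eucl d → ℝ} (hρ : supNorm ρ < ∞) (hρ' : supNorm ρ' < ∞)
    (hf : totalVariation f univ < ∞) {r : ℝ≥0∞} (hw : weightedNorm r ρ f < ∞)
    (hw' : weightedNorm r ρ' f < ∞) (m : ℝ≥0∞) {p q : ℝ} (hp : 0 < p) (hq : 1 ≤ q) :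
    constBV K₀ A₁ f ρ ρ' m p q r < ∞ := by
  have hsum := ENNReal.add_lt_top.2 ⟨hρ, hρ'⟩
  have hwsum := ENNReal.add_lt_top.2 ⟨hw, hw'⟩
  have h2 : ∀ s : ℝ, 0 ≤ s → (2 : ℝ≥0∞) ^ s < ∞ := fun s hs =>
    ENNReal.rpow_lt_top_of_nonneg hs (by simp)
  have hKp : (K₀ : ℝ≥0∞) ^ p < ∞ := ENNReal.rpow_lt_top_of_nonneg hp.le (by simp)
  have hAT : (A₁ : ℝ≥0∞) * (supNorm ρ + supNorm ρ') * totalVariation f univ < ∞ :=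
    ENNReal.mul_lt_top (ENNReal.mul_lt_top ENNReal.coe_lt_top hsum) hf
  unfold constBV
  split_ifs with hr hm
  · rw [weightedNorm, if_pos hr] at hw
    exact ENNReal.mul_lt_top (ENNReal.rpow_lt_top_of_nonneg (by linarith)
      (ENNReal.mul_lt_top (by simp) hw).ne)
      (ENNReal.add_lt_top.2 ⟨ENNReal.mul_lt_top (ENNReal.mul_lt_top (h2 _ (by linarith)) hKp) hw,
        hAT⟩)
  · exact ENNReal.add_lt_top.2 ⟨ENNReal.mul_lt_top (h2 _ (by linarith))
      (ENNReal.add_lt_top.2 ⟨ENNReal.mul_lt_top (h2 _ (by linarith)) hKp, hAT⟩),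
      ENNReal.rpow_lt_top_of_nonneg ENNReal.toReal_nonneg hwsum.ne⟩
  · exact ENNReal.rpow_lt_top_of_nonneg (by linarith) hwsum.ne

variable [IsProbabilityMeasure P]

theorem two_rpow_add_one_mul (K : ℝ≥0∞) {p : ℝ} (hp : 0 < p) :
    (2 : ℝ≥0∞) ^ (p + 1) * K ^ p = 2 * (2 * K) ^ p := by
  rw [ENNReal.rpow_add_of_nonneg _ _ hp.le zero_le_one, ENNReal.rpow_one,
    ENNReal.mul_rpow_of_nonneg _ _ hp.le]
  ring

/-- The case of bounded functions. -/
theorem lintegral_sub_rpow_le_of_bounded {K₀ A₁ : ℝ≥0} (hK : K₀ ∈ pointwiseConstants d)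
    (hA : A₁ ∈ weakTypeConstants d) (hX : Measurable X) (hX' : Measurable X')
    (hρ : IsDensity P X ρ) (hρ' : IsDensity P X' ρ') {p q : ℝ} (hp : 0 < p) (hq : 1 ≤ q)
    {f : Eucl d → ℝ} (hf : IsBV f) (hfb : supNorm f < ∞)
    {m : ℝ≥0∞} (hm : m = ∫⁻ ω, ENNReal.ofReal (‖X ω - X' ω‖ ^ p) ∂P) (hm0 : m ≠ 0) :
    ∫⁻ ω, ‖f (X ω) - f (X' ω)‖ₑ ^ q ∂P ≤
      (2 * supNorm f) ^ (q - 1) * (2 ^ (p + 1) * (K₀ : ℝ≥0∞) ^ p * supNorm f +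
        A₁ * (supNorm ρ + supNorm ρ') * totalVariation f univ) * m ^ (1 / (p + 1)) := by
  set F := supNorm f with hF
  have hae : ∀ᵐ x, ‖f x‖ₑ ≤ F := by
    rw [hF, supNorm, eLpNorm_exponent_top]
    exact ae_le_eLpNormEssSup
  have hX1 := (hρ.quasiMeasurePreserving hX).ae hae
  have hX2 := (hρ'.quasiMeasurePreserving hX').ae hae
  have h2F : 2 * F ≠ ∞ := (ENNReal.mul_lt_top (by simp) hfb).ne
  have hbd : ∀ᵐ ω ∂P, ‖f (X ω) - f (X' ω)‖ₑ ≤ 2 * F := by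
    filter_upwards [hX1, hX2] with ω h1 h2
    rw [two_mul]
    exact enorm_sub_le.trans (add_le_add h1 h2)
  refine (lintegral_enorm_rpow_le_of_bounded hq h2F hbd).trans ?_
  rw [mul_assoc]
  refine mul_le_mul_right ?_ _
  -- For infinite m either f vanishes almost everywhere or the right-hand factor is infinite; the
  -- latter uses K₀ > 0.
  rcases eq_or_ne m ∞ with hmt | hmt
  · rcases eq_or_ne F 0 with h0 | h0
    · have : ∫⁻ ω, ‖f (X ω) - f (X' ω)‖ₑ ∂P = 0 := by
        refine le_antisymm ((lintegral_mono_ae hbd).trans ?_) zero_le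
        simp [h0]
      rw [this]
      exact zero_le
    · have hK0 : (K₀ : ℝ≥0∞) ≠ 0 := by exact_mod_cast hK.1.ne'
      have h1 : (2 : ℝ≥0∞) ^ (p + 1) * (K₀ : ℝ≥0∞) ^ p * F ≠ 0 := by
        refine mul_ne_zero (mul_ne_zero ?_ ?_) h0
        · exact (ENNReal.rpow_pos (by simp) (by simp)).ne'
        · exact (ENNReal.rpow_pos (pos_iff_ne_zero.2 hK0) (by simp)).ne'
      rw [hmt, ENNReal.top_rpow_of_pos (by positivity), ENNReal.mul_top (by simp [h1])]
      exact le_top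
  have hclip : ∫⁻ ω, ‖f (X ω) - f (X' ω)‖ₑ ∂P
      = ∫⁻ ω, ‖clip F.toReal (f (X ω)) - clip F.toReal (f (X' ω))‖ₑ ∂P := by
    have habs : ∀ u : ℝ, ‖u‖ₑ ≤ F → |u| ≤ F.toReal := fun u hu => by
      rwa [Real.enorm_eq_ofReal_abs, ENNReal.ofReal_le_iff_le_toReal hfb.ne] at hu
    refine lintegral_congr_ae ?_
    filter_upwards [hX1, hX2] with ω h1 h2
    rw [clip_of_abs_le (habs _ h1), clip_of_abs_le (habs _ h2)]
  rw [hclip]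
  refine (lintegral_clip_sub_le hK hA hX hX' hρ hρ' hp hf F.toReal hm hm0 hmt).trans
    (le_of_eq ?_)
  rw [ENNReal.ofReal_mul zero_le_two, ENNReal.ofReal_toReal hfb.ne, ENNReal.ofReal_ofNat,
    two_rpow_add_one_mul _ hp]
  ring

/-- The case of functions in a weighted Lebesgue space with finite exponent, when the distance of
the random variables is small. -/
theorem lintegral_sub_rpow_le_of_lt_one {K₀ A₁ : ℝ≥0} (hK : K₀ ∈ pointwiseConstants d)
    (hA : A₁ ∈ weakTypeConstants d) (hX : Measurable X) (hX' : Measurable X')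
    (hρ : IsDensity P X ρ) (hρ' : IsDensity P X' ρ') {p q s : ℝ} (hp : 0 < p) (hq : 1 ≤ q)
    (hqs : q < s) {f : Eucl d → ℝ} (hf : IsBV f)
    {m : ℝ≥0∞} (hm : m = ∫⁻ ω, ENNReal.ofReal (‖X ω - X' ω‖ ^ p) ∂P) (hm0 : m ≠ 0) (hm1 : m < 1) :
    ∫⁻ ω, ‖f (X ω) - f (X' ω)‖ₑ ^ q ∂P ≤
      (2 ^ (q - 1) * (2 ^ (p + 1) * (K₀ : ℝ≥0∞) ^ p +
        A₁ * (supNorm ρ + supNorm ρ') * totalVariation f univ) +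
        (eLpNorm (fun ω => f (X ω)) (ENNReal.ofReal s) P +
          eLpNorm (fun ω => f (X' ω)) (ENNReal.ofReal s) P) ^ s) *
        m ^ ((1 - q / s) / (p + 1)) := by
  have hmt : m ≠ ∞ := (hm1.trans ENNReal.one_lt_top).ne
  have hs : 0 < s := by linarith
  have hq0 : 0 < q := by linarith
  have hp1 : 0 < p + 1 := by linarith
  have hY : AEStronglyMeasurable (fun ω => f (X ω)) P :=
    hf.integrable.aestronglyMeasurable.comp_quasiMeasurePreserving (hρ.quasiMeasurePreserving hX)
  have hY' : AEStronglyMeasurable (fun ω => f (X' ω)) P :=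
    hf.integrable.aestronglyMeasurable.comp_quasiMeasurePreserving (hρ'.quasiMeasurePreserving hX')
  set e := (1 - q / s) / (p + 1) with he
  -- The truncated part is of order L^q m^(1/(p+1)) and the tail of order L^(q-s); this L makes them
  -- equal.
  set L : ℝ≥0∞ := m ^ (-(1 / (s * (p + 1)))) with hL
  have hL0 : L ≠ 0 := (ENNReal.rpow_pos (pos_iff_ne_zero.2 hm0) hmt).ne'
  have hLt : L ≠ ∞ := ENNReal.rpow_ne_top_of_ne_zero hm0 hmt
  have hL1 : 1 ≤ L := by
    rw [hL, ENNReal.rpow_neg, ENNReal.one_le_inv]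
    exact ENNReal.rpow_le_one hm1.le (by positivity)
  have e1 : L ^ (q - s) = m ^ e := by
    rw [hL, ← ENNReal.rpow_mul, he]
    congr 1
    field_simp
    ring
  have e2 : L ^ q * m ^ (1 / (p + 1)) = m ^ e := by
    rw [hL, ← ENNReal.rpow_mul, ← ENNReal.rpow_add _ _ hm0 hmt, he]
    congr 1
    field_simp
    ring
  set lam := L.toReal with hlam
  have hlamL : ENNReal.ofReal lam = L := ENNReal.ofReal_toReal hLt
  set V : Ω → ℝ := fun ω => clip lam (f (X ω)) - clip lam (f (X' ω)) with hV
  set A : Set Ω := {ω | L < ‖f (X ω)‖ₑ} ∪ {ω | L < ‖f (X' ω)‖ₑ} with hAdef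
  have hAm : NullMeasurableSet A P :=
    (nullMeasurableSet_lt aemeasurable_const hY.enorm).union
      (nullMeasurableSet_lt aemeasurable_const hY'.enorm)
  have hpt : ∀ ω, ‖f (X ω) - f (X' ω)‖ₑ ^ q ≤
      ‖V ω‖ₑ ^ q + A.indicator (fun ω => ‖f (X ω) - f (X' ω)‖ₑ ^ q) ω := by
    intro ω
    by_cases hω : ω ∈ A
    · rw [indicator_of_mem hω]
      exact le_add_self
    · have habs : ∀ u : ℝ, ¬ L < ‖u‖ₑ → |u| ≤ lam := fun u hu => by
        rwa [not_lt, Real.enorm_eq_ofReal_abs, ENNReal.ofReal_le_iff_le_toReal hLt] at hu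
      rw [hV]
      simp only
      rw [clip_of_abs_le (habs _ fun h => hω (Or.inl h)),
        clip_of_abs_le (habs _ fun h => hω (Or.inr h))]
      exact le_self_add
  have hVm : AEMeasurable (fun ω => ‖V ω‖ₑ ^ q) P :=
    (((continuous_clip lam).comp_aestronglyMeasurable hY).sub
      ((continuous_clip lam).comp_aestronglyMeasurable hY')).enorm.pow_const q
  have hVb : ∀ᵐ ω ∂P, ‖V ω‖ₑ ≤ 2 * L := ae_of_all _ fun ω => by
    have hc : ∀ u, ‖clip lam u‖ₑ ≤ L := fun u => by
      rw [Real.enorm_eq_ofReal_abs, ← hlamL]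
      exact ENNReal.ofReal_le_ofReal (abs_clip_le ENNReal.toReal_nonneg u)
    rw [two_mul]
    exact enorm_sub_le.trans (add_le_add (hc _) (hc _))
  set Q : ℝ≥0∞ := A₁ * (supNorm ρ + supNorm ρ') * totalVariation f univ with hQ
  have hbulk : ∫⁻ ω, ‖V ω‖ₑ ^ q ∂P ≤
      2 ^ (q - 1) * (2 ^ (p + 1) * (K₀ : ℝ≥0∞) ^ p + Q) * m ^ e := by
    have h2L : 2 * L ≠ ∞ := ENNReal.mul_ne_top (by simp) hLt
    calc _ ≤ (2 * L) ^ (q - 1) * ∫⁻ ω, ‖V ω‖ₑ ∂P := lintegral_enorm_rpow_le_of_bounded hq h2L hVb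
      _ ≤ (2 * L) ^ (q - 1) * ((ENNReal.ofReal (2 * lam) * (2 * (K₀ : ℝ≥0∞)) ^ p + Q) *
            m ^ (1 / (p + 1))) := by
          gcongr
          exact lintegral_clip_sub_le hK hA hX hX' hρ hρ' hp hf lam hm hm0 hmt
      -- Since m < 1 gives L ≥ 1, the variation term may be multiplied by L so that both terms carry
      -- the same power.
      _ ≤ (2 * L) ^ (q - 1) * ((2 * L * (2 * (K₀ : ℝ≥0∞)) ^ p + L * Q) * m ^ (1 / (p + 1))) := by
          rw [ENNReal.ofReal_mul zero_le_two, hlamL, ENNReal.ofReal_ofNat]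
          gcongr
          exact le_mul_of_one_le_left' hL1
      _ = 2 ^ (q - 1) * (2 ^ (p + 1) * (K₀ : ℝ≥0∞) ^ p + Q) *
            ((L ^ (q - 1) * L) * m ^ (1 / (p + 1))) := by
          rw [ENNReal.mul_rpow_of_nonneg _ _ (by linarith), two_rpow_add_one_mul _ hp]
          ring
      _ = _ := by
          rw [← e2]
          congr 2
          nth_rewrite 2 [← ENNReal.rpow_one L]
          rw [← ENNReal.rpow_add _ _ hL0 hLt, sub_add_cancel]
  calc ∫⁻ ω, ‖f (X ω) - f (X' ω)‖ₑ ^ q ∂P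
      ≤ ∫⁻ ω, ‖V ω‖ₑ ^ q + A.indicator (fun ω => ‖f (X ω) - f (X' ω)‖ₑ ^ q) ω ∂P :=
        lintegral_mono hpt
    _ = (∫⁻ ω, ‖V ω‖ₑ ^ q ∂P) + ∫⁻ ω in A, ‖f (X ω) - f (X' ω)‖ₑ ^ q ∂P := by
        rw [lintegral_add_left' hVm, lintegral_indicator₀ hAm]
    _ ≤ _ := by
        rw [add_mul, ← e1]
        refine add_le_add (hbulk.trans (by rw [e1])) ?_
        exact setLIntegral_tail_le hY hY' hq0 hqs.le (by linarith) hL0 hLt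

end Main

end Avikainen

theorem theorem2p11 (d : ℕ) (hd : 0 < d) :
    -- the two dimensional constants exist
    (Avikainen.pointwiseConstants d).Nonempty ∧ (Avikainen.weakTypeConstants d).Nonempty ∧
    -- and the estimate holds for every choice of them
    ∀ K₀ ∈ Avikainen.pointwiseConstants d, ∀ A₁ ∈ Avikainen.weakTypeConstants d,
    ∀ (Ω : Type*) [MeasurableSpace Ω] (P : Measure Ω) [IsProbabilityMeasure P]
      (X X' : Ω → Avikainen.Eucl d) (ρ ρ' : Avikainen.Eucl d → ℝ),
      Measurable X → Measurable X' →
      Avikainen.IsDensity P X ρ → Avikainen.IsDensity P X' ρ' →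
      Avikainen.supNorm ρ < ∞ → Avikainen.supNorm ρ' < ∞ →
    ∀ r : ℝ≥0∞, 1 < r →
    ∀ f : Avikainen.Eucl d → ℝ, Avikainen.IsBV f →
      Avikainen.weightedNorm r ρ f < ∞ → Avikainen.weightedNorm r ρ' f < ∞ →
    ∀ p q : ℝ, 0 < p → 1 ≤ q → ENNReal.ofReal q < r →
      Avikainen.constBV K₀ A₁ f ρ ρ' (∫⁻ ω, ENNReal.ofReal (‖X ω - X' ω‖ ^ p) ∂P) p q r < ∞ ∧
      ∫⁻ ω, ENNReal.ofReal (|f (X ω) - f (X' ω)| ^ q) ∂P ≤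
        Avikainen.constBV K₀ A₁ f ρ ρ' (∫⁻ ω, ENNReal.ofReal (‖X ω - X' ω‖ ^ p) ∂P) p q r *
          (∫⁻ ω, ENNReal.ofReal (‖X ω - X' ω‖ ^ p) ∂P) ^ ((1 - q * (r⁻¹).toReal) / (p + 1)) := by
  refine ⟨Avikainen.pointwiseConstants_nonempty d, Avikainen.weakTypeConstants_nonempty hd, ?_⟩
  intro K₀ hK A₁ hA Ω _ P _ X X' ρ ρ' hX hX' hρ hρ' hρb hρb' r hr f hf hw hw' p q hp hq hqr
  refine ⟨Avikainen.constBV_lt_top K₀ A₁ hρb hρb' hf.totalVariation_lt_top hw hw' _ hp hq, ?_⟩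
  have hq0 : 0 < q := by linarith
  obtain ⟨m, hm⟩ : ∃ m, m = ∫⁻ ω, ENNReal.ofReal (‖X ω - X' ω‖ ^ p) ∂P := ⟨_, rfl⟩
  have hleft : ∫⁻ ω, ENNReal.ofReal (|f (X ω) - f (X' ω)| ^ q) ∂P
      = ∫⁻ ω, ‖f (X ω) - f (X' ω)‖ₑ ^ q ∂P := lintegral_congr fun ω => by
    rw [Real.enorm_eq_ofReal_abs, ENNReal.ofReal_rpow_of_nonneg (abs_nonneg _) hq0.le]
  rw [← hm, hleft]
  -- The levels above are negative powers of m, so m = 0 is separate: then X = X' almost surely.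
  rcases eq_or_ne m 0 with hm0 | hm0
  · have hae : ∀ᵐ ω ∂P, X ω = X' ω := by
      have hdm : Measurable fun ω => ENNReal.ofReal (‖X ω - X' ω‖ ^ p) :=
        ((hX.sub hX').norm.pow_const p).ennreal_ofReal
      rw [hm, lintegral_eq_zero_iff hdm] at hm0
      filter_upwards [hm0] with ω hω
      simp only [Pi.zero_apply, ENNReal.ofReal_eq_zero] at hω
      by_contra hne
      exact absurd (Real.rpow_pos_of_pos (norm_pos_iff.2 (sub_ne_zero.2 hne)) p) (not_lt.2 hω)
    have : ∫⁻ ω, ‖f (X ω) - f (X' ω)‖ₑ ^ q ∂P = 0 := by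
      rw [← lintegral_zero (μ := P)]
      refine lintegral_congr_ae ?_
      filter_upwards [hae] with ω hω
      rw [hω, sub_self, enorm_zero, ENNReal.zero_rpow_of_pos hq0]
    rw [this]
    exact zero_le
  rcases eq_or_ne r ∞ with rfl | hrt
  · rw [Avikainen.weightedNorm, if_pos rfl] at hw
    have h := Avikainen.lintegral_sub_rpow_le_of_bounded hK hA hX hX' hρ hρ' hp hq hf hw hm hm0
    rw [Avikainen.constBV, if_pos rfl]
    simpa using h
  have hr0 : r ≠ 0 := (zero_lt_one.trans hr).ne'
  have hfm := hf.integrable.aestronglyMeasurable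
  have hs1 : 1 < r.toReal := by
    rw [← ENNReal.toReal_one]
    exact (ENNReal.toReal_lt_toReal ENNReal.one_ne_top hrt).2 hr
  have hqs : q < r.toReal := (ENNReal.ofReal_lt_iff_lt_toReal hq0.le hrt).1 hqr
  have hexp : 1 - q * (r⁻¹).toReal = 1 - q / r.toReal := by rw [ENNReal.toReal_inv]; rfl
  have hrs : ENNReal.ofReal r.toReal = r := ENNReal.ofReal_toReal hrt
  rw [Avikainen.constBV, if_neg hrt, hρ.weightedNorm_eq_eLpNorm hX hfm hr0 hrt,
    hρ'.weightedNorm_eq_eLpNorm hX' hfm hr0 hrt, hexp]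
  split_ifs with hm1
  · have h := Avikainen.lintegral_sub_rpow_le_of_lt_one hK hA hX hX' hρ hρ' hp hq hqs hf hm hm0 hm1
    rwa [hrs] at h
  · have hY := hfm.comp_quasiMeasurePreserving (hρ.quasiMeasurePreserving hX)
    have hY' := hfm.comp_quasiMeasurePreserving (hρ'.quasiMeasurePreserving hX')
    have hexp0 : 0 < (1 - q / r.toReal) / (p + 1) := by
      refine div_pos ?_ (by linarith)
      rw [sub_pos, div_lt_one (by linarith)]
      exact hqs
    -- For m ≥ 1 monotonicity of norms on a probability space and the triangle inequality in L^r
    -- suffice, because the power of m is at least one.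
    calc ∫⁻ ω, ‖f (X ω) - f (X' ω)‖ₑ ^ q ∂P
        = eLpNorm (fun ω => f (X ω) - f (X' ω)) (ENNReal.ofReal q) P ^ q :=
          Avikainen.lintegral_enorm_rpow_eq_eLpNorm_rpow _ _ hq0
      _ ≤ (eLpNorm (fun ω => f (X ω)) r P + eLpNorm (fun ω => f (X' ω)) r P) ^ q := by
          gcongr
          exact (eLpNorm_le_eLpNorm_of_exponent_le hqr.le (hY.sub hY')).trans
            (eLpNorm_sub_le hY hY' hr.le)
      _ ≤ _ := le_mul_of_one_le_right zero_le (ENNReal.one_le_rpow (not_lt.1 hm1) hexp0)
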